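/- Let $n\in\{2,3\}$ and let $\Omega\subset\mathbb R^n$ be a bounded, simply connected open set with Lipschitz boundary $\Gamma=\partial\Omega$, such that the geodesic distance on $\Gamma$ is bounded by a constant times the Euclidean distance (curvilinear polygons and polyhedra are included). With $ds$ the surface measure on $\Gamma$, put $$|v|_{1/2,\Gamma}^2=\int_\Gamma\int_\Gamma\frac{|v(t)-v(s)|^2}{|t-s|^n}\,ds\,dt,\qquad \|v\|_{1/2,\Gamma}^2=\|v\|_{L^2(\Gamma)}^2+|v|_{1/2,\Gamma}^2,$$ let $H^{1/2}(\Gamma)=\{v\in L^2(\Gamma):|v|_{1/2,\Gamma}<\infty\}$, and let $H^{-1/2}(\Gamma)$ be its dual, with the dual norm $\|\zeta\|_{-1/2,\Gamma}=\sup_{v\ne0}\langle\zeta,v\rangle/\|v\|_{1/2,\Gamma}$. For $\tau\subseteq\Gamma$ let $H^{1/2}_{00}(\tau)$ be the space of the $v\in H^{1/2}(\Gamma)$ that vanish a.e. on $\Gamma\setminus\tau$, with $\|v\|_{H^{1/2}_{00}(\tau)}=|v|_{1/2,\Gamma}$, and for $\zeta\in H^{-1/2}(\Gamma)$ put $$\|\zeta\|_{\widetilde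 H^{-1/2}(\tau)}=\sup_{0\ne v\in H^{1/2}_{00}(\tau)}\frac{\langle\zeta,v\rangle}{\|v\|_{H^{1/2}_{00}(\tau)}}\qquad(0/0:=0).$$ A mesh $\mathcal T_h$ on $\Gamma$ is a decomposition of $\Gamma$ into finitely many closed, possibly curvilinear, non-overlapping segments ($n=2$) or triangles ($n=3$) $T=F_T(\hat T)$, with $F_T$ continuous and injective on the reference simplex $\hat T$ and $h=\max_T\operatorname{diam}T$; hanging nodes are allowed. It is shape regular with constant $\kappa$ if $\kappa^{-1}\operatorname{diam}(T)\,|x-y|\le|F_T(x)-F_T(y)|\le\kappa\operatorname{diam}(T)\,|x-y|$ for all $T$ and all $x,y\in\hat T$ (distances in $\hat T$ being maximum distances of barycentric coordinates), and quasi-uniform with constant $\kappa$ if $h\le\kappa\operatorname{diam}T$ for all $T$. Let $\mathcal N$ be the set of vertices of the elements, and for $\mathbf y\in\mathcal N$ let $\omega_{\mathbf y}=\bigcup\{T\in\mathcal T_h:\mathbf y\in\partial T\}$. Let $W^{1,\infty}_0(\omega_{\mathbf y})$ be the space of functions on $\omega_{\mathbf y}$ whose extension by zero to $\Gamma$ is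 Lipschitz, with $|\phi|_{1,\infty,\omega_{\mathbf y}}=\operatorname{ess\,sup}_{\omega_{\mathbf y}}|\nabla_\Gamma\phi|$. Then for all constants $\kappa>0$, $c_0$, $c_1$ there is a constant $C>0$, depending only on $\Omega,\kappa,c_0,c_1$ (in particular not on $h$), such that the following holds for every mesh $\mathcal T_h$ on $\Gamma$ that is shape regular and quasi-uniform with constant $\kappa$. Let $\{\phi^{\mathbf y},\ \mathbf y\in\mathcal N\}\subset H^{1/2}(\Gamma)$ satisfy $\phi^{\mathbf y}\in W^{1,\infty}_0(\omega_{\mathbf y})$, $$\|\phi^{\mathbf y}\|_{0,\infty,\omega_{\mathbf y}}\le c_0,\qquad|\phi^{\mathbf y}|_{1,\infty,\omega_{\mathbf y}}\le c_1h^{-1}\quad\text{for all }\mathbf y\in\mathcal N,\qquad\sum_{\mathbf y\in\mathcal N}\phi^{\mathbf y}=1.$$ Then every $\zeta\in H^{-1/2}(\Gamma)$ with $\langle\zeta,\phi^{\mathbf y}\rangle=0$ for all $\mathbf y\in\mathcal N$ satisfies $$C^{-1}\|\zeta\|_{-1/2,\Gamma}^2\ \le\ \sum_{\mathbf y\in\mathcal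 N}\|\zeta\|_{\widetilde H^{-1/2}(\omega_{\mathbf y})}^2\ \le\ C\,\|\zeta\|_{-1/2,\Gamma}^2 .$$ -/

import Mathlib

open MeasureTheory Set Filter Topology
open scoped NNReal ENNReal RealInnerProductSpace

noncomputable section

namespace TraceNorms

/-- Euclidean space `ℝⁿ`. -/
abbrev E (n : ℕ) := EuclideanSpace ℝ (Fin n)

/-! ### The domain -/

/-- `Ω` is open and its boundary is Lipschitz: near each boundary point, `Ω` is the set of points
lying strictly above the graph of a Lipschitz function `g` defined on a hyperplane `νᗮ`. -/
def IsLipschitzDomain {n : ℕ} (Ω : Set (E n)) : Prop :=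
  IsOpen Ω ∧ ∀ x ∈ frontier Ω, ∃ (ν : E n) (g : (ℝ ∙ ν)ᗮ → ℝ) (K : ℝ≥0) (r : ℝ),
    ‖ν‖ = 1 ∧ LipschitzWith K g ∧ 0 < r ∧
      ∀ y ∈ Metric.ball x r, y ∈ Ω ↔ g ((ℝ ∙ ν)ᗮ.orthogonalProjectionOnto y) < ⟪ν, y⟫

/-- Geodesic distance on `Γ`: infimum of the lengths of the paths in `Γ` joining `x` to `y`. -/
def geodesicDist {n : ℕ} (Γ : Set (E n)) (x y : E n) : ℝ≥0∞ :=
  ⨅ (γ : Path x y) (_ : ∀ t, γ t ∈ Γ), eVariationOn γ univ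

/-- The geodesic distance on `Γ` is bounded by a constant times the Euclidean distance. -/
def IsNondegenerate {n : ℕ} (Γ : Set (E n)) : Prop :=
  ∃ C : ℝ≥0, ∀ x ∈ Γ, ∀ y ∈ Γ, geodesicDist Γ x y ≤ C * edist x y

/-! ### Fractional Sobolev spaces on `Γ` -/

/-- Surface measure on `Γ ⊆ ℝⁿ`: the `(n-1)`-dimensional Hausdorff measure, normalized so as to
agree with Lebesgue measure on hyperplanes. -/
def surfaceMeasure {n : ℕ} (Γ : Set (E n)) : Measure (E n) :=
  (μHE[n - 1] : Measure (E n)).restrict Γ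

/-- `|v|²_{1/2,τ} = ∫_τ ∫_τ |v(t) - v(s)|² / |t - s|ⁿ ds dt`. -/
def seminormSq {n : ℕ} (τ : Set (E n)) (v : E n → ℝ) : ℝ≥0∞ :=
  ∫⁻ t, ∫⁻ s, ‖v t - v s‖ₑ ^ 2 / edist t s ^ n ∂(surfaceMeasure τ) ∂(surfaceMeasure τ)

theorem seminormSq_congr {n : ℕ} {τ : Set (E n)} {v w : E n → ℝ}
    (h : v =ᵐ[surfaceMeasure τ] w) : seminormSq τ v = seminormSq τ w := by
  refine lintegral_congr_ae ?_
  filter_upwards [h] with t ht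
  refine lintegral_congr_ae ?_
  filter_upwards [h] with s hs
  rw [ht, hs]

theorem seminormSq_smul_lt_top {n : ℕ} {τ : Set (E n)} {v : E n → ℝ} (c : ℝ)
    (hv : seminormSq τ v < ∞) : seminormSq τ (c • v) < ∞ := by
  have key : seminormSq τ (c • v) = ‖c‖ₑ ^ 2 * seminormSq τ v := by
    have hc : ‖c‖ₑ ^ 2 ≠ ∞ := by simp
    unfold seminormSq
    rw [← lintegral_const_mul' _ _ hc]
    refine lintegral_congr fun t => ?_
    rw [← lintegral_const_mul' _ _ hc]
    refine lintegral_congr fun s => ?_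
    simp only [Pi.smul_apply, smul_eq_mul, ← mul_sub, enorm_mul, mul_pow, mul_div_assoc]
  rw [key]
  exact ENNReal.mul_lt_top (by simp) hv

theorem measurable_lintegral_inv_edist_pow {n : ℕ} (μ : Measure (E n)) :
    Measurable fun t : E n => ∫⁻ s, (edist t s ^ n)⁻¹ ∂μ := by
  refine measurable_of_Iic fun y => IsClosed.measurableSet (IsSeqClosed.isClosed ?_)
  intro x t hx hxt
  have hcont : ∀ s : E n, Tendsto (fun k => (edist (x k) s ^ n)⁻¹) atTop (𝓝 (edist t s ^ n)⁻¹) :=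
    fun s => ((((ENNReal.continuous_pow n).comp
      (continuous_id.edist continuous_const)).inv.tendsto t).comp hxt)
  calc ∫⁻ s, (edist t s ^ n)⁻¹ ∂μ
      = ∫⁻ s, liminf (fun k => (edist (x k) s ^ n)⁻¹) atTop ∂μ :=
        lintegral_congr fun s => (hcont s).liminf_eq.symm
    _ ≤ liminf (fun k => ∫⁻ s, (edist (x k) s ^ n)⁻¹ ∂μ) atTop :=
        lintegral_liminf_le fun k => ((measurable_const.edist measurable_id).pow_const n).inv
    _ ≤ y := liminf_le_of_le (by isBoundedDefault) fun b hb => by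
        obtain ⟨k, hk⟩ := hb.exists
        exact hk.trans (hx k)

theorem measurable_inner_seminormSq {n : ℕ} {μ : Measure (E n)} {v : E n → ℝ}
    (hv : FinStronglyMeasurable v μ) :
    Measurable fun t : E n => ∫⁻ s, ‖v t - v s‖ₑ ^ 2 / edist t s ^ n ∂μ := by
  obtain ⟨A, hA, hvA, hAσ⟩ := hv.exists_set_sigmaFinite
  have hvm : Measurable v := hv.stronglyMeasurable.measurable
  have hsplit : (fun t : E n => ∫⁻ s, ‖v t - v s‖ₑ ^ 2 / edist t s ^ n ∂μ) = fun t =>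
      (∫⁻ s in A, ‖v t - v s‖ₑ ^ 2 / edist t s ^ n ∂μ) +
        ‖v t‖ₑ ^ 2 * ∫⁻ s in Aᶜ, (edist t s ^ n)⁻¹ ∂μ := by
    funext t
    rw [← lintegral_add_compl _ hA, ← lintegral_const_mul' _ _ (by simp)]
    congr 1
    refine setLIntegral_congr_fun hA.compl fun s hs => ?_
    simp only [hvA s hs, sub_zero, div_eq_mul_inv]
  rw [hsplit]
  refine Measurable.add (Measurable.lintegral_prod_right' (f := fun p : E n × E n =>
    ‖v p.1 - v p.2‖ₑ ^ 2 / edist p.1 p.2 ^ n) ?_) ?_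
  · exact (((hvm.comp measurable_fst).sub (hvm.comp measurable_snd)).enorm.pow_const 2).div
      ((measurable_fst.edist measurable_snd).pow_const n)
  · exact (hvm.enorm.pow_const 2).mul (measurable_lintegral_inv_edist_pow _)

theorem seminormSq_add_lt_top {n : ℕ} {τ : Set (E n)} {v w : E n → ℝ}
    (hvm : FinStronglyMeasurable v (surfaceMeasure τ)) (hv : seminormSq τ v < ∞)
    (hw : seminormSq τ w < ∞) : seminormSq τ (v + w) < ∞ := by
  have hvm' : Measurable v := hvm.stronglyMeasurable.measurable
  have key : seminormSq τ (v + w) ≤ 2 * (seminormSq τ v + seminormSq τ w) := by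
    unfold seminormSq
    rw [← lintegral_add_left (measurable_inner_seminormSq hvm),
      ← lintegral_const_mul' _ _ (by simp)]
    refine lintegral_mono fun t => ?_
    have hm : Measurable fun s : E n => ‖v t - v s‖ₑ ^ 2 / edist t s ^ n :=
      ((measurable_const.sub hvm').enorm.pow_const 2).div
        ((measurable_const.edist measurable_id).pow_const n)
    rw [← lintegral_add_left hm, ← lintegral_const_mul' _ _ (by simp)]
    refine lintegral_mono fun s => ?_
    rw [← ENNReal.add_div, ← mul_div_assoc]
    refine ENNReal.div_le_div_right ?_ _
    have h1 : (v + w) t - (v + w) s = (v t - v s) + (w t - w s) := by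
      simp only [Pi.add_apply]; ring
    rw [h1]
    have h2 := ENNReal.rpow_add_le_mul_rpow_add_rpow ‖v t - v s‖ₑ ‖w t - w s‖ₑ
      (p := 2) (by norm_num)
    norm_num at h2
    exact (pow_le_pow_left' (enorm_add_le _ _) 2).trans h2
  exact key.trans_lt (ENNReal.mul_lt_top (by simp) (ENNReal.add_lt_top.2 ⟨hv, hw⟩))

/-- `f` represents an element of `H^{1/2}(Γ)`. -/
def MemHHalf {n : ℕ} (Γ : Set (E n)) (f : E n → ℝ) : Prop :=
  MemLp f 2 (surfaceMeasure Γ) ∧ seminormSq Γ f < ∞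

/-- The space `H^{1/2}(Γ)`, a subspace of `L²(Γ)`. -/
def HHalf {n : ℕ} (Γ : Set (E n)) : Submodule ℝ (Lp ℝ 2 (surfaceMeasure Γ)) where
  carrier := {v | seminormSq Γ v < ∞}
  zero_mem' := by
    have h : seminormSq Γ ((0 : Lp ℝ 2 (surfaceMeasure Γ)) : E n → ℝ) = seminormSq Γ 0 :=
      seminormSq_congr (Lp.coeFn_zero _ _ _)
    rw [mem_ofPred_eq, h]
    simp [seminormSq]
  add_mem' := by
    intro v w hv hw
    rw [mem_ofPred_eq, seminormSq_congr (Lp.coeFn_add v w)]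
    exact seminormSq_add_lt_top (Lp.finStronglyMeasurable v (by simp) (by simp)) hv hw
  smul_mem' := by
    intro c v hv
    rw [mem_ofPred_eq, seminormSq_congr (Lp.coeFn_smul c v)]
    exact seminormSq_smul_lt_top c hv

/-- The element of `H^{1/2}(Γ)` represented by a function. -/
def MemHHalf.toHHalf {n : ℕ} {Γ : Set (E n)} {f : E n → ℝ} (hf : MemHHalf Γ f) : HHalf Γ :=
  ⟨hf.1.toLp f, by
    change seminormSq Γ _ < ∞
    rw [seminormSq_congr hf.1.coeFn_toLp]
    exact hf.2⟩

/-- `‖v‖_{1/2,Γ}`, where `‖v‖²_{1/2,Γ} = ‖v‖²_{0,Γ} + |v|²_{1/2,Γ}`. -/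
def normHHalf {n : ℕ} {Γ : Set (E n)} (v : HHalf Γ) : ℝ≥0∞ :=
  (eLpNorm v.1 2 (surfaceMeasure Γ) ^ 2 + seminormSq Γ v.1) ^ (1 / 2 : ℝ)

/-- The space `H^{1/2}_{00}(τ)`, `τ ⊆ Γ`. Its elements are identified with their extensions by
zero, so that it consists of the `v ∈ H^{1/2}(Γ)` that vanish almost everywhere on `Γ \ τ`. -/
def HHalf00 {n : ℕ} (Γ τ : Set (E n)) : Submodule ℝ (HHalf Γ) where
  carrier := {v | ∀ᵐ s ∂(surfaceMeasure Γ), s ∉ τ → v.1 s = 0}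
  zero_mem' := by
    filter_upwards [Lp.coeFn_zero ℝ 2 (surfaceMeasure Γ)] with s hs _
    exact hs
  add_mem' := by
    intro v w hv hw
    filter_upwards [hv, hw, Lp.coeFn_add v.1 w.1] with s h1 h2 h3 hs
    change (v.1 + w.1 : Lp ℝ 2 (surfaceMeasure Γ)) s = 0
    rw [h3, Pi.add_apply, h1 hs, h2 hs, add_zero]
  smul_mem' := by
    intro c v hv
    filter_upwards [hv, Lp.coeFn_smul c v.1] with s h1 h3 hs
    change (c • v.1 : Lp ℝ 2 (surfaceMeasure Γ)) s = 0
    rw [h3, Pi.smul_apply, h1 hs, smul_zero]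

/-- `‖v‖_{H^{1/2}_{00}(τ)}`: the `H^{1/2}(Γ)` seminorm of the extension by zero. -/
def normHHalf00 {n : ℕ} {Γ τ : Set (E n)} (v : HHalf00 Γ τ) : ℝ≥0∞ :=
  seminormSq Γ v.1.1 ^ (1 / 2 : ℝ)

/-- Dual norm `‖ζ‖_{-1/2,Γ}` of a linear functional on `H^{1/2}(Γ)`
(equal to `∞` if the functional is unbounded). -/
def negNorm {n : ℕ} {Γ : Set (E n)} (ζ : HHalf Γ →ₗ[ℝ] ℝ) : ℝ≥0∞ :=
  ⨆ (v : HHalf Γ) (_ : v ≠ 0), ‖ζ v‖ₑ / normHHalf v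

/-- Dual norm `‖ζ‖_{H̃^{-1/2}(τ)}` of (the restriction to `H^{1/2}_{00}(τ)` of) a linear
functional on `H^{1/2}(Γ)`. -/
def negNormTilde {n : ℕ} {Γ : Set (E n)} (τ : Set (E n)) (ζ : HHalf Γ →ₗ[ℝ] ℝ) : ℝ≥0∞ :=
  ⨆ (v : HHalf00 Γ τ) (_ : v ≠ 0), ‖ζ v.1‖ₑ / normHHalf00 v

/-- The space `H^{-1/2}(Γ)`: bounded linear functionals on `H^{1/2}(Γ)`. -/
def HNegHalf {n : ℕ} (Γ : Set (E n)) : Set (HHalf Γ →ₗ[ℝ] ℝ) :=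
  {ζ | negNorm ζ < ∞}

/-! ### `W^{1,∞}_0` on subsets of `Γ` -/

/-- `f`, which stands for its extension by zero to `Γ`, belongs to `W^{1,∞}_0(τ)`: it is Lipschitz
on `Γ` and vanishes outside `τ` (so, by continuity, also on the relative boundary of `τ`). -/
def MemW1Inf0 {n : ℕ} (Γ τ : Set (E n)) (f : E n → ℝ) : Prop :=
  (∃ K : ℝ≥0, LipschitzOnWith K f Γ) ∧ ∀ s ∈ Γ \ τ, f s = 0

/-- `|∇_Γ f(s)|`, the size of the tangential gradient of `f`, computed as the limit superior of the
difference quotients of `f` along `Γ` (for Lipschitz `f` it exists in the classical sense at almost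
every `s`, and the two agree there). -/
def tangentialSlope {n : ℕ} (Γ : Set (E n)) (f : E n → ℝ) (s : E n) : ℝ≥0∞ :=
  limsup (fun t => ‖f t - f s‖ₑ / edist t s) (𝓝[Γ \ {s}] s)

/-- `‖f‖_{0,∞,τ}`. -/
def norm0Inf {n : ℕ} (τ : Set (E n)) (f : E n → ℝ) : ℝ≥0∞ :=
  eLpNorm f ∞ (surfaceMeasure τ)

/-- `|f|_{1,∞,τ}`, the essential supremum over `τ ⊆ Γ` of `|∇_Γ f|`. -/
def seminorm1Inf {n : ℕ} (Γ τ : Set (E n)) (f : E n → ℝ) : ℝ≥0∞ :=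
  essSup (tangentialSlope Γ f) (surfaceMeasure τ)

/-! ### Meshes -/

/-- A decomposition of `Γ ⊆ ℝⁿ` into finitely many (possibly curvilinear) closed simplices of
dimension `n - 1` (segments if `n = 2`, triangles if `n = 3`), each one parametrized by the
reference simplex. Distinct elements do not overlap; hanging nodes are permitted. -/
structure Mesh {n : ℕ} (Γ : Set (E n)) where
  /-- number of elements -/
  card : ℕ
  /-- parametrizations of the elements -/
  F : Fin card → (Fin n → ℝ) → E n
  continuousOn : ∀ i, ContinuousOn (F i) (stdSimplex ℝ (Fin n))
  injOn : ∀ i, InjOn (F i) (stdSimplex ℝ (Fin n))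
  cover : ⋃ i, F i '' stdSimplex ℝ (Fin n) = Γ
  disjoint : ∀ i j, i ≠ j →
    Disjoint (F i '' {x ∈ stdSimplex ℝ (Fin n) | ∀ k, 0 < x k}) (F j '' stdSimplex ℝ (Fin n))

namespace Mesh

variable {n : ℕ} {Γ : Set (E n)} (M : Mesh Γ)

/-- The element `T`. -/
def elem (i : Fin M.card) : Set (E n) := M.F i '' stdSimplex ℝ (Fin n)

/-- The boundary `∂T` of the element `T`. -/
def bdry (i : Fin M.card) : Set (E n) := M.F i '' {x ∈ stdSimplex ℝ (Fin n) | ∃ k, x k = 0}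

open Classical in
/-- The nodes: the vertices of the elements. -/
def nodes : Finset (E n) :=
  Finset.univ.image fun p : Fin M.card × Fin n => M.F p.1 (Pi.single p.2 1)

/-- The patch `ω_y`: the union of the elements `T` with `y ∈ ∂T`. -/
def patch (y : E n) : Set (E n) := ⋃ (i : Fin M.card) (_ : y ∈ M.bdry i), M.elem i

/-- The mesh size `h`, the largest diameter of an element. -/
def size : ℝ := ⨆ i, Metric.diam (M.elem i)

/-- Shape regularity, with constant `κ`: each parametrization, rescaled by the diameter of its
element, is bi-Lipschitz with constant `κ`. -/
def IsShapeRegular (κ : ℝ) : Prop :=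
  ∀ i, ∀ x ∈ stdSimplex ℝ (Fin n), ∀ y ∈ stdSimplex ℝ (Fin n),
    κ⁻¹ * Metric.diam (M.elem i) * dist x y ≤ dist (M.F i x) (M.F i y) ∧
      dist (M.F i x) (M.F i y) ≤ κ * Metric.diam (M.elem i) * dist x y

/-- Quasi-uniformity, with constant `κ`. -/
def IsQuasiUniform (κ : ℝ) : Prop := ∀ i, M.size ≤ κ * Metric.diam (M.elem i)

end Mesh

end TraceNorms

end

noncomputable section

namespace TraceNorms

/-! Let `h` be the mesh size, `ω_y` the patches and `|·|` the seminorm on `Γ`. Since the `φ^y` add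
up to `1`, the functional `ζ` annihilates the constants as well as every `φ^y`.

Local norms by the global one: by a Poincaré inequality on `Γ`, vanishing on constants gives
`|ζ(w)|² ≤ Q ‖ζ‖² |w|²`, with only the seminorm of `w` (`enorm_sq_le_of_const_eq_zero`).
Near-extremal `w_y` in the patch spaces are scaled so that `ζ(w_y) = b_y²` and `|w_y|² ≤ b_y²`. At
most `N` patches meet at a point, so `|∑ w_y|² ≤ 2N ∑ b_y²`; testing `ζ` with `∑ w_y` bounds `∑
b_y²` (`sum_negNormTilde_sq_le`).

Global norm by the local ones: write `v = ∑ φ^y (v - a_y) + ∑ a_y φ^y`, where `ζ` kills the second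
sum. For suitable `a_y`, the seminorm squared of `φ^y (v - a_y)` is at most a constant times the
double integral of `|v(t) - v(s)|² / |t - s|ⁿ` over `ω_y × Γ` (`exists_cutoff_seminorm_le`). These
integrals add up to at most `N |v|²`, and Cauchy–Schwarz concludes (`negNorm_sq_le`).

In the cutoff estimate, Poincaré on `ω_y` yields a factor `h` and the integral of `min(1, |t -
s|/h)² / |t - s|ⁿ` a factor `1/h`, which cancel. The geometric input is: balls of radius `r` have
surface measure `≲ r^(n-1)`; elements have measure `≳ h^(n-1)`, which also yields `N`; and the a.e.
gradient bound on `φ^y` implies a Lipschitz bound with constant depending on `Ω`, `c₀`, `c₁` over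
`h` (`IsLipschitzDomain.exists_cutoff_bound`). -/

/-! ### From a.e. slope bounds to Lipschitz bounds in a vector space -/

/-- The difference quotients of `f` at `x` along `S` are asymptotically at most `m`. -/
def SlopeLE {X : Type*} [PseudoMetricSpace X] (S : Set X) (f : X → ℝ) (m : ℝ) (x : X) : Prop :=
  ∀ m' > m, ∀ᶠ t in 𝓝[S] x, |f t - f x| ≤ m' * dist t x

/-- Lipschitz functions are absolutely continuous, so the increment is the integral of the
derivative, which is at most `L` in size wherever the slope bound holds. The constant `K` does not
enter the bound. -/
theorem abs_sub_le_of_ae_slopeLE {ψ : ℝ → ℝ} {K : ℝ≥0} {L : ℝ} (hL : 0 ≤ L)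
    (hψ : LipschitzOnWith K ψ (Icc 0 1))
    (h : ∀ᵐ t : ℝ, t ∈ Ioo (0 : ℝ) 1 → SlopeLE univ ψ L t) : |ψ 1 - ψ 0| ≤ L := by
  have hac : AbsolutelyContinuousOnInterval ψ 0 1 := by
    apply LipschitzOnWith.absolutelyContinuousOnInterval (K := K)
    rwa [uIcc_of_le zero_le_one]
  rw [← hac.integral_deriv_eq_sub]
  have h1 : ∀ᵐ t : ℝ, t ≠ 1 := by simp [ae_iff, measure_singleton]
  have := intervalIntegral.norm_integral_le_of_norm_le_const_ae (a := (0 : ℝ)) (b := 1) (C := L)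
    (f := deriv ψ) ?_
  · simpa using this
  filter_upwards [h, h1] with t ht ht1 hmem
  rw [uIoc_of_le zero_le_one] at hmem
  refine le_of_forall_gt_imp_ge_of_dense fun m' hm' => ?_
  refine norm_deriv_le_of_lip' (hL.trans hm'.le) ?_
  have := ht ⟨hmem.1, lt_of_le_of_ne hmem.2 ht1⟩ m' hm'
  rw [nhdsWithin_univ] at this
  filter_upwards [this] with s hs
  rwa [Real.dist_eq] at hs

/-- The segment from `a` to `b` may lie inside the exceptional null set. The one-dimensional bound
is therefore applied on parallel segments with starting points `z` close to `a`, and continuity of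
`u` lets `z` tend to `a`. -/
theorem lipschitz_of_ae_slopeLE {H : Type*} [NormedAddCommGroup H] [NormedSpace ℝ H]
    [FiniteDimensional ℝ H] [MeasurableSpace H] [BorelSpace H] (μ : Measure H) [μ.IsAddHaarMeasure]
    {u : H → ℝ} {K : ℝ≥0} {p : H} {ρ m : ℝ} (hm : 0 ≤ m)
    (hu : LipschitzOnWith K u (Metric.ball p ρ))
    (h : ∀ᵐ z ∂μ, z ∈ Metric.ball p ρ → SlopeLE univ u m z)
    {a b : H} (ha : a ∈ Metric.ball p ρ) (hb : b ∈ Metric.ball p ρ) :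
    |u b - u a| ≤ m * dist b a := by
  set e := b - a with he
  obtain ⟨N, hN, hNm, hN0⟩ := exists_measurable_superset_of_null (ae_iff.1 h)
  -- Fubini on `H × ℝ`: for fixed `τ` the bad set of `z` is a translate of `N`, hence null.
  have hae : ∀ᵐ z ∂μ, ∀ᵐ τ : ℝ, z + τ • e ∉ N := by
    have hmeas : MeasurableSet {q : H × ℝ | q.1 + q.2 • e ∈ N} :=
      hNm.preimage (by fun_prop)
    have h2 : ∀ᵐ q ∂(μ.prod (volume : Measure ℝ)), q.1 + q.2 • e ∉ N := by
      rw [ae_iff]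
      simp only [not_not]
      rw [Measure.prod_apply_symm hmeas]
      simp only [preimage_ofPred_eq]
      rw [lintegral_eq_zero_of_ae_eq_zero]
      filter_upwards with τ
      have : {z | z + τ • e ∈ N} = (fun z => z + τ • e) ⁻¹' N := rfl
      rw [this, measure_preimage_add_right, hN0]; rfl
    exact Measure.ae_ae_of_ae_prod h2
  have hcont : ContinuousOn u (Metric.ball p ρ) := hu.continuousOn
  have hab : Tendsto (fun z => z + e) (𝓝 a) (𝓝 b) := by
    have h1 : Continuous fun z : H => z + e := by fun_prop
    have h2 := h1.tendsto a
    rwa [he, add_sub_cancel] at h2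
  have hev : ∀ᶠ z in 𝓝 a, z ∈ Metric.ball p ρ ∧ z + e ∈ Metric.ball p ρ :=
    Filter.Eventually.and (Metric.isOpen_ball.mem_nhds ha)
      (hab (Metric.isOpen_ball.mem_nhds hb))
  have hfreq : ∃ᶠ z in 𝓝 a, |u (z + e) - u z| ≤ m * dist b a := by
    have hd : Dense {z | ∀ᵐ τ : ℝ, z + τ • e ∉ N} := Measure.dense_of_ae hae
    refine ((mem_closure_iff_frequently.1 (hd a)).and_eventually hev).mono ?_
    rintro z ⟨hz, hz0, hz1⟩
    have hseg : ∀ τ ∈ Icc (0 : ℝ) 1, z + τ • e ∈ Metric.ball p ρ := by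
      intro τ hτ
      have := (convex_ball p ρ).add_smul_sub_mem hz0 hz1 hτ
      simpa using this
    have := abs_sub_le_of_ae_slopeLE (ψ := fun τ : ℝ => u (z + τ • e)) (K := K * ‖e‖₊)
      (L := m * dist b a) (by positivity) ?_ ?_
    · simpa using this
    · refine LipschitzOnWith.comp (f := fun τ : ℝ => z + τ • e) hu ?_ fun τ hτ => hseg τ hτ
      refine LipschitzWith.lipschitzOnWith (LipschitzWith.of_dist_le_mul fun s t => ?_)
      rw [dist_add_left, dist_eq_norm, ← sub_smul, norm_smul, mul_comm, Real.dist_eq]; rfl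
    · filter_upwards [hz] with τ hτ hτ1 m' hm'
      have hs : SlopeLE univ u m (z + τ • e) := by
        by_contra hcon
        refine hτ (hN ?_)
        simp only [Classical.not_imp]
        exact ⟨hseg τ (Ioo_subset_Icc_self hτ1), hcon⟩
      have hdb : dist b a = ‖e‖ := dist_eq_norm _ _
      rcases eq_or_ne e 0 with h0 | h0
      · have : m' > 0 := by simpa [hdb, h0] using hm'
        simp only [h0]
        filter_upwards with t
        simp; positivity
      have hpos : 0 < ‖e‖ := norm_pos_iff.2 h0
      have hm2 : m' / ‖e‖ > m := by
        rw [gt_iff_lt, lt_div_iff₀ hpos, ← hdb]; exact hm'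
      have h3 := hs _ hm2
      rw [nhdsWithin_univ] at h3 ⊢
      have hc : Tendsto (fun σ : ℝ => z + σ • e) (𝓝 τ) (𝓝 (z + τ • e)) :=
        Continuous.tendsto (by fun_prop) τ
      filter_upwards [hc.eventually h3] with σ hσ
      refine hσ.trans (le_of_eq ?_)
      rw [dist_add_left, dist_eq_norm, ← sub_smul, norm_smul, Real.dist_eq, Real.norm_eq_abs]
      field_simp
  have hua : Tendsto u (𝓝 a) (𝓝 (u a)) := hcont.continuousAt (Metric.isOpen_ball.mem_nhds ha)
  have hub : Tendsto u (𝓝 b) (𝓝 (u b)) := hcont.continuousAt (Metric.isOpen_ball.mem_nhds hb)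
  exact (isClosed_Iic (a := m * dist b a)).mem_of_frequently_of_tendsto hfreq
    ((hub.comp hab).sub hua).abs

/-! ### Lipschitz charts of the boundary -/

/-- The hyperplane orthogonal to `ν`. -/
abbrev Hyp {n : ℕ} (ν : E n) : Submodule ℝ (E n) := (ℝ ∙ ν)ᗮ

/-- Orthogonal projection onto the hyperplane orthogonal to `ν`. -/
abbrev hypProj {n : ℕ} (ν : E n) (y : E n) : Hyp ν := (Hyp ν).orthogonalProjectionOnto y

/-- The point of the graph of `g` above `z`. -/
def graphMap {n : ℕ} (ν : E n) (g : Hyp ν → ℝ) (z : Hyp ν) : E n := (z : E n) + g z • ν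

section Chart

variable {n : ℕ} {ν : E n} {g : Hyp ν → ℝ}

theorem hypProj_add_smul (y : E n) (t : ℝ) : hypProj ν (y + t • ν) = hypProj ν y := by
  have h : hypProj ν (t • ν) = 0 := by
    rw [Submodule.orthogonalProjectionOnto_eq_zero_iff, Submodule.orthogonal_orthogonal]
    exact Submodule.smul_mem _ _ (Submodule.mem_span_singleton_self ν)
  simp only [hypProj] at h ⊢
  rw [map_add, h, add_zero]

theorem inner_hyp (z : Hyp ν) : ⟪ν, (z : E n)⟫ = 0 :=
  Submodule.mem_orthogonal_singleton_iff_inner_right.1 z.2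

theorem hypProj_graphMap (z : Hyp ν) : hypProj ν (graphMap ν g z) = z := by
  rw [graphMap, hypProj_add_smul]
  exact Submodule.orthogonalProjectionOnto_mem_subspace_eq_self z

theorem inner_graphMap (hν : ‖ν‖ = 1) (z : Hyp ν) : ⟪ν, graphMap ν g z⟫ = g z := by
  rw [graphMap, inner_add_right, inner_hyp, inner_smul_right, real_inner_self_eq_norm_sq, hν]
  simp

theorem graphMap_hypProj (hν : ‖ν‖ = 1) {y : E n} (hy : g (hypProj ν y) = ⟪ν, y⟫) :
    graphMap ν g (hypProj ν y) = y := by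
  have h := Submodule.starProjection_add_starProjection_orthogonal (K := ℝ ∙ ν) y
  rw [Submodule.starProjection_unit_singleton ℝ hν] at h
  rw [graphMap, hy, add_comm]
  exact h

theorem dist_hypProj_le (x y : E n) : dist (hypProj ν x) (hypProj ν y) ≤ dist x y := by
  rw [dist_eq_norm, dist_eq_norm]
  simp only [hypProj]
  rw [← map_sub]
  exact Submodule.norm_orthogonalProjectionOnto_apply_le _ _

theorem dist_graphMap_le {K : ℝ≥0} (hν : ‖ν‖ = 1) (hg : LipschitzWith K g) (z w : Hyp ν) :
    dist (graphMap ν g z) (graphMap ν g w) ≤ (1 + K) * dist z w := by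
  have h := hg.dist_le_mul z w
  rw [dist_eq_norm, graphMap, graphMap, add_sub_add_comm, ← sub_smul]
  refine (norm_add_le _ _).trans ?_
  rw [norm_smul, hν, mul_one, add_mul, one_mul, ← dist_eq_norm, ← dist_eq_norm]
  exact add_le_add le_rfl h

theorem finrank_hyp (hν : ‖ν‖ = 1) : Module.finrank ℝ (Hyp ν) = n - 1 := by
  have h0 : ν ≠ 0 := by rintro rfl; simp at hν
  have h1 := Submodule.finrank_add_finrank_orthogonal (ℝ ∙ ν)
  rw [finrank_span_singleton h0, finrank_euclideanSpace_fin] at h1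
  simp only [Hyp]; omega

theorem isAddHaarMeasure_hyp (hν : ‖ν‖ = 1) :
    (μHE[n - 1] : Measure (Hyp ν)).IsAddHaarMeasure := by
  rw [← finrank_hyp hν]; infer_instance

end Chart

/-- Points strictly below the graph have a neighbourhood missing `Ω`, points on it are limits of
points `y + t • ν` of `Ω` as `t ↓ 0`, and points above it lie in the open set `Ω`. -/
theorem IsLipschitzDomain.exists_chart {n : ℕ} {Ω : Set (E n)} (hΩ : IsLipschitzDomain Ω)
    {x : E n} (hx : x ∈ frontier Ω) : ∃ (ν : E n) (g : Hyp ν → ℝ) (K : ℝ≥0) (r : ℝ),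
      ‖ν‖ = 1 ∧ LipschitzWith K g ∧ 0 < r ∧
        ∀ y ∈ Metric.ball x r, y ∈ frontier Ω ↔ g (hypProj ν y) = ⟪ν, y⟫ := by
  obtain ⟨ν, g, K, r, hν, hg, hr, h⟩ := hΩ.2 x hx
  refine ⟨ν, g, K, r, hν, hg, hr, fun y hy => ?_⟩
  rw [hΩ.1.frontier_eq, Set.mem_sdiff, h y hy, not_lt]
  have hgc : Continuous fun y : E n => g (hypProj ν y) := hg.continuous.comp (by fun_prop)
  constructor
  · rintro ⟨hcl, hle⟩
    refine le_antisymm ?_ hle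
    by_contra! hlt
    have hopen : IsOpen {y : E n | ⟪ν, y⟫ < g (hypProj ν y)} := isOpen_lt (by fun_prop) hgc
    obtain ⟨w, ⟨hw1, hw2⟩, hw3⟩ := mem_closure_iff.1 hcl _ (hopen.inter Metric.isOpen_ball) ⟨hlt, hy⟩
    exact lt_asymm hw1 ((h w hw2).1 hw3)
  · intro heq
    refine ⟨?_, heq.ge⟩
    have hc : Tendsto (fun t : ℝ => y + t • ν) (𝓝[>] 0) (𝓝 y) := by
      have h1 : Continuous fun t : ℝ => y + t • ν := by fun_prop
      have h2 := h1.tendsto 0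
      simp only [zero_smul, add_zero] at h2
      exact h2.mono_left nhdsWithin_le_nhds
    refine mem_closure_of_tendsto hc ?_
    filter_upwards [hc (Metric.isOpen_ball.mem_nhds hy), self_mem_nhdsWithin] with t ht htpos
    rw [h _ ht]
    have h3 := hypProj_add_smul (ν := ν) y t
    simp only [hypProj] at h3 heq
    rw [h3, inner_add_right, inner_smul_right, real_inner_self_eq_norm_sq, hν, heq]
    have : (0 : ℝ) < t := htpos
    linarith

/-! ### Surface measure of balls -/

theorem _root_.LipschitzOnWith.euclideanHausdorffMeasure_image_le {X Y : Type*}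
    [EMetricSpace X] [MeasurableSpace X] [BorelSpace X]
    [EMetricSpace Y] [MeasurableSpace Y] [BorelSpace Y] {f : X → Y} {K : ℝ≥0} {s : Set X}
    (hf : LipschitzOnWith K f s) (d : ℕ) : μHE[d] (f '' s) ≤ (K : ℝ≥0∞) ^ d * μHE[d] s := by
  have h := hf.hausdorffMeasure_image_le (d := d) (Nat.cast_nonneg d)
  rw [ENNReal.rpow_natCast] at h
  simp only [Measure.euclideanHausdorffMeasure_def, Measure.smul_apply, ENNReal.smul_def,
    smul_eq_mul]
  rw [mul_left_comm]
  gcongr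

theorem isCompact_frontier_of_isBounded {n : ℕ} {Ω : Set (E n)} (hΩb : Bornology.IsBounded Ω) :
    IsCompact (frontier Ω) :=
  Metric.isCompact_of_isClosed_isBounded isClosed_frontier
    (hΩb.closure.subset frontier_subset_closure)

/-- The property passes to subsets and to unions, so compactness reduces it to one chart. There the
part of the frontier in a ball is covered by the Lipschitz image of a ball of the same radius in the
hyperplane. -/
theorem frontier_measure_closedBall_le {n : ℕ} {Ω : Set (E n)} (hΩ : IsLipschitzDomain Ω)
    (hΩb : Bornology.IsBounded Ω) : ∃ A : ℝ≥0, ∀ (x : E n) (r : ℝ), 0 ≤ r →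
      surfaceMeasure (frontier Ω) (Metric.closedBall x r) ≤ A * ENNReal.ofReal r ^ (n - 1) := by
  have hcomp := isCompact_frontier_of_isBounded hΩb
  refine hcomp.induction_on (p := fun S => ∃ A : ℝ≥0, ∀ (x : E n) (r : ℝ), 0 ≤ r →
      surfaceMeasure S (Metric.closedBall x r) ≤ A * ENNReal.ofReal r ^ (n - 1)) ?_ ?_ ?_ ?_
  · exact ⟨0, by simp [surfaceMeasure]⟩
  · rintro s t hst ⟨A, hA⟩
    exact ⟨A, fun x r hr => (Measure.restrict_mono hst le_rfl _).trans (hA x r hr)⟩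
  · rintro s t ⟨A, hA⟩ ⟨B, hB⟩
    refine ⟨A + B, fun x r hr => ?_⟩
    have h1 : surfaceMeasure (s ∪ t) (Metric.closedBall x r) ≤
        surfaceMeasure s (Metric.closedBall x r) + surfaceMeasure t (Metric.closedBall x r) :=
      Measure.restrict_union_le s t _
    refine h1.trans ?_
    rw [ENNReal.coe_add, add_mul]
    exact add_le_add (hA x r hr) (hB x r hr)
  · intro x₀ hx₀
    obtain ⟨ν, g, K, ρ, hν, hg, hρ, h⟩ := hΩ.exists_chart hx₀
    have := isAddHaarMeasure_hyp hν
    set c := (μHE[n - 1] : Measure (Hyp ν)) (Metric.closedBall 0 1) with hc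
    have hcfin : c ≠ ∞ := (isCompact_closedBall _ _).measure_lt_top.ne
    refine ⟨Metric.ball x₀ ρ ∩ frontier Ω,
      Filter.inter_mem (mem_nhdsWithin_of_mem_nhds (Metric.ball_mem_nhds _ hρ))
        self_mem_nhdsWithin,
      (1 + K) ^ (n - 1) * c.toNNReal, fun x r hr => ?_⟩
    rw [surfaceMeasure, Measure.restrict_apply measurableSet_closedBall]
    have hsub : Metric.closedBall x r ∩ (Metric.ball x₀ ρ ∩ frontier Ω) ⊆
        graphMap ν g '' Metric.closedBall (hypProj ν x) r := by
      rintro y ⟨hy1, hy2, hy3⟩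
      exact ⟨hypProj ν y, (dist_hypProj_le y x).trans hy1, graphMap_hypProj hν ((h y hy2).1 hy3)⟩
    have hlip : LipschitzWith (1 + K) (graphMap ν g) :=
      LipschitzWith.of_dist_le_mul fun z w => by simpa using dist_graphMap_le hν hg z w
    refine (measure_mono hsub).trans ((hlip.lipschitzOnWith.euclideanHausdorffMeasure_image_le
      (n - 1)).trans ?_)
    rw [Measure.addHaar_closedBall' _ _ hr, finrank_hyp hν, ENNReal.ofReal_pow hr, ENNReal.coe_mul, ENNReal.coe_toNNReal hcfin,
      ENNReal.coe_pow, mul_assoc, mul_comm c]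

/-! ### Lipschitz bounds on the boundary and for the cutoffs -/

/-- Pulled back by the graph map, `f` has slope at most `(1 + Kg) * m` almost everywhere on a ball
of the hyperplane, and balls are convex. The resulting `L` depends on the chart alone, not on the
Lipschitz constant `K` of `f`. -/
theorem IsLipschitzDomain.exists_local_lipschitz {n : ℕ} {Ω : Set (E n)}
    (hΩ : IsLipschitzDomain Ω) {x : E n} (hx : x ∈ frontier Ω) :
    ∃ ρ > 0, ∃ L : ℝ, 0 ≤ L ∧ ∀ (f : E n → ℝ) (K : ℝ≥0) (m : ℝ), LipschitzOnWith K f (frontier Ω) →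
      0 ≤ m → (∀ᵐ s ∂(surfaceMeasure (frontier Ω)), SlopeLE (frontier Ω) f m s) →
      ∀ s ∈ frontier Ω, ∀ t ∈ frontier Ω, s ∈ Metric.ball x ρ → t ∈ Metric.ball x ρ →
        |f s - f t| ≤ L * m * dist s t := by
  obtain ⟨ν, g, Kg, r, hν, hg, hr, h⟩ := hΩ.exists_chart hx
  have hΓ : MeasurableSet (frontier Ω) := isClosed_frontier.measurableSet
  have hpos : (0 : ℝ) < 1 + Kg := by positivity
  -- The graph map is `(1 + Kg)`-Lipschitz: this radius keeps the graph over the projected ball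
  -- inside the ball where the chart is valid.
  refine ⟨r / (1 + Kg), by positivity, 1 + Kg, hpos.le, fun f K m hf hm hslope s hs t ht hsx htx => ?_⟩
  have := isAddHaarMeasure_hyp hν
  have hlip : LipschitzWith (1 + Kg) (graphMap ν g) :=
    LipschitzWith.of_dist_le_mul fun z w => by simpa using dist_graphMap_le hν hg z w
  have hgx := graphMap_hypProj hν ((h x (Metric.mem_ball_self hr)).1 hx)
  have hball : ∀ z ∈ Metric.ball (hypProj ν x) (r / (1 + Kg)),
      graphMap ν g z ∈ frontier Ω := by
    intro z hz
    have hz' : graphMap ν g z ∈ Metric.ball x r := by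
      have h1 := dist_graphMap_le hν hg z (hypProj ν x)
      rw [hgx] at h1
      rw [Metric.mem_ball] at hz ⊢
      rw [lt_div_iff₀ hpos] at hz
      linarith
    rw [h _ hz', hypProj_graphMap, inner_graphMap hν]
  have hu : LipschitzOnWith (K * (1 + Kg)) (fun z => f (graphMap ν g z))
      (Metric.ball (hypProj ν x) (r / (1 + Kg))) :=
    LipschitzOnWith.comp (f := graphMap ν g) hf hlip.lipschitzOnWith hball
  have hae : ∀ᵐ z ∂(μHE[n - 1] : Measure (Hyp ν)), z ∈ Metric.ball (hypProj ν x) (r / (1 + Kg)) →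
      SlopeLE (frontier Ω) f m (graphMap ν g z) := by
    rw [surfaceMeasure, ae_restrict_iff' hΓ, ae_iff] at hslope
    rw [ae_iff]
    simp only [Classical.not_imp] at hslope ⊢
    -- The projection is 1-Lipschitz, so it sends the exceptional null subset of the frontier to a
    -- null set of the hyperplane.
    set B := {a | a ∈ frontier Ω ∧ ¬SlopeLE (frontier Ω) f m a}
    have hP : LipschitzWith 1 (hypProj ν) := LipschitzWith.of_dist_le_mul fun y w => by
      simpa using dist_hypProj_le y w
    have h1 := hP.lipschitzOnWith.euclideanHausdorffMeasure_image_le (s := B) (n - 1)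
    rw [hslope, mul_zero] at h1
    refine measure_mono_null ?_ (le_antisymm h1 bot_le)
    rintro z ⟨hz1, hz2⟩
    exact ⟨graphMap ν g z, ⟨hball z hz1, hz2⟩, hypProj_graphMap z⟩
  have hae2 : ∀ᵐ z ∂(μHE[n - 1] : Measure (Hyp ν)), z ∈ Metric.ball (hypProj ν x) (r / (1 + Kg)) →
      SlopeLE univ (fun z => f (graphMap ν g z)) ((1 + Kg) * m) z := by
    filter_upwards [hae] with z hz hzb m' hm'
    have h1 := hz hzb (m' / (1 + Kg)) (by rw [gt_iff_lt, lt_div_iff₀ hpos]; linarith)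
    have h2 : Tendsto (graphMap ν g) (𝓝 z) (𝓝[frontier Ω] (graphMap ν g z)) := by
      refine tendsto_nhdsWithin_iff.2 ⟨hlip.continuous.tendsto z, ?_⟩
      filter_upwards [Metric.isOpen_ball.mem_nhds hzb] with w hw using hball w hw
    rw [nhdsWithin_univ]
    filter_upwards [h2.eventually h1] with w hw
    refine hw.trans ?_
    have h3 := dist_graphMap_le hν hg w z
    have h4 : 0 ≤ m' / (1 + Kg) := div_nonneg ((by positivity : 0 ≤ (1 + Kg) * m).trans hm'.le) hpos.le
    calc m' / (1 + Kg) * dist (graphMap ν g w) (graphMap ν g z)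
        ≤ m' / (1 + Kg) * ((1 + Kg) * dist w z) := by gcongr
      _ = m' * dist w z := by field_simp
  have hsr : s ∈ Metric.ball x r := Metric.ball_subset_ball (div_le_self hr.le (by simp)) hsx
  have htr : t ∈ Metric.ball x r := Metric.ball_subset_ball (div_le_self hr.le (by simp)) htx
  have key := lipschitz_of_ae_slopeLE (μHE[n - 1] : Measure (Hyp ν)) (mul_nonneg hpos.le hm) hu hae2
    (a := hypProj ν t) (b := hypProj ν s)
    (lt_of_le_of_lt (dist_hypProj_le t x) htx) (lt_of_le_of_lt (dist_hypProj_le s x) hsx)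
  simp only [graphMap_hypProj hν ((h s hsr).1 hs), graphMap_hypProj hν ((h t htr).1 ht)] at key
  exact key.trans (mul_le_mul_of_nonneg_left (dist_hypProj_le s t) (mul_nonneg hpos.le hm))

/-- Points closer than a Lebesgue number `δ` of a finite cover by chart balls share a chart; the sum
of the local constants serves for all of them. -/
theorem IsLipschitzDomain.exists_uniform_lipschitz {n : ℕ} {Ω : Set (E n)}
    (hΩ : IsLipschitzDomain Ω) (hΩb : Bornology.IsBounded Ω) :
    ∃ δ > 0, ∃ L : ℝ, 0 ≤ L ∧ ∀ (f : E n → ℝ) (K : ℝ≥0) (m : ℝ), LipschitzOnWith K f (frontier Ω) →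
      0 ≤ m → (∀ᵐ s ∂(surfaceMeasure (frontier Ω)), SlopeLE (frontier Ω) f m s) →
      ∀ s ∈ frontier Ω, ∀ t ∈ frontier Ω, dist s t < δ → |f s - f t| ≤ L * m * dist s t := by
  have hcomp := isCompact_frontier_of_isBounded hΩb
  choose! ρ hρ L hL hfL using fun x (hx : x ∈ frontier Ω) => hΩ.exists_local_lipschitz hx
  obtain ⟨T, hT, hcover⟩ := hcomp.elim_nhds_subcover (fun x => Metric.ball x (ρ x))
    fun x hx => Metric.ball_mem_nhds x (hρ x hx)
  obtain ⟨δ, hδ, hδT⟩ := lebesgue_number_lemma_of_metric (ι := T)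
    (c := fun x => Metric.ball (x : E n) (ρ x)) hcomp (fun _ => Metric.isOpen_ball)
    fun y hy => by
      obtain ⟨x, hx, hy⟩ := mem_iUnion₂.1 (hcover hy)
      exact mem_iUnion.2 ⟨⟨x, hx⟩, hy⟩
  refine ⟨δ, hδ, ∑ x ∈ T, L x, Finset.sum_nonneg fun x hx => hL x (hT x hx),
    fun f K m hf hm hslope s hs t ht hst => ?_⟩
  obtain ⟨⟨x, hxT⟩, hx⟩ := hδT s hs
  refine (hfL x (hT x hxT) f K m hf hm hslope s hs t ht (hx (Metric.mem_ball_self hδ))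
    (hx (Metric.mem_ball'.2 hst))).trans ?_
  have h1 : L x ≤ ∑ x ∈ T, L x :=
    Finset.single_le_sum (f := L) (fun y hy => hL y (hT y hy)) hxT
  gcongr

theorem slopeLE_of_tangentialSlope_le {n : ℕ} {Γ : Set (E n)} {f : E n → ℝ} {s : E n} {m : ℝ}
    (hm : 0 ≤ m) (h : tangentialSlope Γ f s ≤ ENNReal.ofReal m) : SlopeLE Γ f m s := by
  intro m' hm'
  have hm0 : 0 < m' := hm.trans_lt hm'
  have h1 : tangentialSlope Γ f s < ENNReal.ofReal m' :=
    h.trans_lt ((ENNReal.ofReal_lt_ofReal_iff hm0).2 hm')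
  have h2 := eventually_lt_of_limsup_lt h1
  rw [eventually_nhdsWithin_iff] at h2 ⊢
  filter_upwards [h2] with t ht htΓ
  rcases eq_or_ne t s with rfl | hts
  · simp
  have h3 := ht ⟨htΓ, hts⟩
  have h4 : ‖f t - f s‖ₑ ≤ ENNReal.ofReal m' * edist t s := by
    rw [ENNReal.div_lt_iff (Or.inl (edist_pos.2 hts).ne') (Or.inl (edist_ne_top _ _))] at h3
    exact h3.le
  rw [edist_dist, ← ENNReal.ofReal_mul hm0.le, Real.enorm_eq_ofReal_abs,
    ENNReal.ofReal_le_ofReal_iff (by positivity)] at h4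
  exact h4

theorem ae_surfaceMeasure_of_subset {n : ℕ} {Γ τ : Set (E n)} (hτ : MeasurableSet τ)
    {p : E n → Prop} (h : ∀ᵐ s ∂(surfaceMeasure τ), p s) :
    ∀ᵐ s ∂(surfaceMeasure Γ), s ∈ τ → p s :=
  ae_restrict_of_ae ((ae_restrict_iff' hτ).1 h)

theorem IsLipschitzDomain.exists_cutoff_bound {n : ℕ} {Ω : Set (E n)}
    (hΩ : IsLipschitzDomain Ω) (hΩb : Bornology.IsBounded Ω) (c₀ c₁ : ℝ) :
    ∃ B : ℝ, 0 ≤ B ∧ ∀ (τ : Set (E n)) (h : ℝ) (φ : E n → ℝ), IsClosed τ → 0 < h →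
      h ≤ Metric.diam (frontier Ω) → MemW1Inf0 (frontier Ω) τ φ →
      norm0Inf τ φ ≤ ENNReal.ofReal c₀ →
      seminorm1Inf (frontier Ω) τ φ ≤ ENNReal.ofReal (c₁ / h) →
      (∀ᵐ t ∂(surfaceMeasure (frontier Ω)), |φ t| ≤ B) ∧
      ∀ᵐ t ∂(surfaceMeasure (frontier Ω)), ∀ᵐ s ∂(surfaceMeasure (frontier Ω)),
        |φ t - φ s| ≤ B * min 1 (dist t s / h) := by
  obtain ⟨δ, hδ, L, hL, hlip⟩ := hΩ.exists_uniform_lipschitz hΩb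
  set D := Metric.diam (frontier Ω)
  have hD : 0 ≤ D := Metric.diam_nonneg
  have hc0 : 0 ≤ max c₀ 0 := le_max_right _ _
  have hc1 : 0 ≤ max c₁ 0 := le_max_right _ _
  set a := max c₀ 0
  set b := max c₁ 0
  -- `2 * a` serves distances at least `h`, `L * b` those below `δ`, and `2 * a * (D / δ)` those
  -- between `δ` and `h`, where `dist t s / h ≥ δ / D` because `h ≤ D`.
  refine ⟨2 * a + (L * b + 2 * a * (D / δ)), by positivity,
    fun τ h φ hτ hh hhD hφ h0 h1 => ?_⟩
  obtain ⟨⟨K, hK⟩, hφ0⟩ := hφ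
  have hΓm : ∀ᵐ s ∂(surfaceMeasure (frontier Ω)), s ∈ frontier Ω :=
    ae_restrict_mem isClosed_frontier.measurableSet
  have hbd : ∀ᵐ t ∂(surfaceMeasure (frontier Ω)), |φ t| ≤ a := by
    have h2 : ∀ᵐ s ∂(surfaceMeasure τ), |φ s| ≤ a := by
      rw [norm0Inf, eLpNorm_exponent_top] at h0
      filter_upwards [enorm_ae_le_eLpNormEssSup φ (surfaceMeasure τ)] with s hs
      have h3 := hs.trans (h0.trans (ENNReal.ofReal_le_ofReal (le_max_left c₀ 0)))
      rwa [Real.enorm_eq_ofReal_abs, ENNReal.ofReal_le_ofReal_iff hc0] at h3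
    filter_upwards [hΓm, ae_surfaceMeasure_of_subset hτ.measurableSet h2] with s hs1 hs2
    by_cases hs : s ∈ τ
    · exact hs2 hs
    · rw [hφ0 s ⟨hs1, hs⟩, abs_zero]; exact hc0
  have hslope : ∀ᵐ s ∂(surfaceMeasure (frontier Ω)), SlopeLE (frontier Ω) φ (b / h) s := by
    have h2 : ∀ᵐ s ∂(surfaceMeasure τ), SlopeLE (frontier Ω) φ (b / h) s := by
      filter_upwards [ENNReal.ae_le_essSup (μ := surfaceMeasure τ)
        (tangentialSlope (frontier Ω) φ)] with s hs
      refine slopeLE_of_tangentialSlope_le (by positivity) (hs.trans (h1.trans ?_))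
      exact ENNReal.ofReal_le_ofReal (by gcongr; exact le_max_left _ _)
    filter_upwards [hΓm, ae_surfaceMeasure_of_subset hτ.measurableSet h2] with s hs1 hs2
    by_cases hs : s ∈ τ
    · exact hs2 hs
    -- Off the closed set `τ`, `φ` vanishes on a whole neighbourhood in the frontier, so its slope
    -- is zero.
    · intro m' hm'
      have hm0 : 0 < m' := (by positivity : 0 ≤ b / h).trans_lt hm'
      rw [eventually_nhdsWithin_iff]
      filter_upwards [hτ.isOpen_compl.mem_nhds hs] with t ht htΓ
      rw [hφ0 s ⟨hs1, hs⟩, hφ0 t ⟨htΓ, ht⟩, sub_zero, abs_zero]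
      positivity
  refine ⟨?_, ?_⟩
  · filter_upwards [hbd] with t ht
    have : 0 ≤ L * b + 2 * a * (D / δ) := by positivity
    linarith
  filter_upwards [hΓm, hbd] with t htΓ ht
  filter_upwards [hΓm, hbd] with s hsΓ hs
  have h2a : |φ t - φ s| ≤ 2 * a := by
    have := abs_sub (φ t) (φ s)
    linarith
  have hx : 0 ≤ L * b + 2 * a * (D / δ) := by positivity
  have hq : 0 ≤ dist t s / h := by positivity
  rcases le_total 1 (dist t s / h) with hle | hle
  · rw [min_eq_left hle]; linarith
  rw [min_eq_right hle]
  rcases lt_or_ge (dist t s) δ with hd | hd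
  · have h3 := hlip φ K (b / h) hK (by positivity) hslope t htΓ s hsΓ hd
    have h4 : L * (b / h) * dist t s = L * b * (dist t s / h) := by ring
    have h5 : 0 ≤ (2 * a + 2 * a * (D / δ)) * (dist t s / h) := by positivity
    linarith
  · have h3 : 1 ≤ (D / δ) * (dist t s / h) := by
      rw [div_mul_div_comm, le_div_iff₀ (by positivity), one_mul, mul_comm δ h]
      gcongr
    have h4 : 2 * a * 1 ≤ 2 * a * ((D / δ) * (dist t s / h)) := by gcongr
    have h5 : 0 ≤ (2 * a + L * b) * (dist t s / h) := by positivity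
    linarith

/-! ### Meshes -/

/-- The relative interior of the standard simplex. -/
def openSimplex (n : ℕ) : Set (Fin n → ℝ) := {x ∈ stdSimplex ℝ (Fin n) | ∀ k, 0 < x k}

/-- Dropping the first barycentric coordinate is 1-Lipschitz, and the image contains the cube `(0,
1/(m+1))^m` of positive volume. -/
theorem measure_openSimplex_pos {n : ℕ} (hn : 2 ≤ n) :
    0 < (μHE[n - 1] : Measure (Fin n → ℝ)) (openSimplex n) := by
  obtain ⟨m, rfl⟩ : ∃ m, n = m + 1 := ⟨n - 1, by omega⟩
  set p : (Fin (m + 1) → ℝ) → (Fin m → ℝ) := fun x i => x i.succ with hp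
  have hpl : LipschitzWith 1 p := LipschitzWith.of_dist_le_mul fun x y => by
    rw [NNReal.coe_one, one_mul, dist_pi_le_iff dist_nonneg]
    exact fun i => dist_le_pi_dist x y i.succ
  have h1 := hpl.lipschitzOnWith.hausdorffMeasure_image_le (s := openSimplex (m + 1)) (d := m)
    (Nat.cast_nonneg m)
  have hsub : (univ.pi fun _ : Fin m => Ioo (0 : ℝ) (1 / (m + 1))) ⊆ p '' openSimplex (m + 1) := by
    intro y hy
    have hy' : ∀ i, y i ∈ Ioo (0 : ℝ) (1 / (m + 1)) := fun i => hy i (mem_univ i)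
    have hsum : ∑ i, y i < 1 := by
      calc ∑ i, y i ≤ ∑ _i : Fin m, (1 / (m + 1) : ℝ) := Finset.sum_le_sum fun i _ => (hy' i).2.le
        _ = m / (m + 1) := by simp [div_eq_mul_inv]
        _ < 1 := by rw [div_lt_one (by positivity)]; linarith
    have hpos : ∀ k, 0 < (Fin.cons (1 - ∑ i, y i) y : Fin (m + 1) → ℝ) k := by
      intro k
      refine Fin.cases ?_ (fun i => ?_) k
      · simpa using hsum
      · simpa using (hy' i).1
    refine ⟨Fin.cons (1 - ∑ i, y i) y, ⟨⟨fun k => (hpos k).le, ?_⟩, hpos⟩, ?_⟩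
    · simp [Fin.sum_univ_succ]
    · ext i; simp [hp]
  have h2 : 0 < (μH[(m : ℝ)] : Measure (Fin m → ℝ)) (p '' openSimplex (m + 1)) := by
    have h3 : (μH[(m : ℝ)] : Measure (Fin m → ℝ)) = volume := by
      have := hausdorffMeasure_pi_real (ι := Fin m)
      rwa [Fintype.card_fin] at this
    rw [h3]
    refine lt_of_lt_of_le ?_ (measure_mono hsub)
    rw [volume_pi_pi]
    simp only [Real.volume_Ioo, sub_zero, Finset.prod_const]
    exact ENNReal.pow_pos (ENNReal.ofReal_pos.2 (by positivity)) _
  have h4 : 0 < (μH[(m : ℝ)] : Measure (Fin (m + 1) → ℝ)) (openSimplex (m + 1)) := by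
    simpa using h2.trans_le h1
  rw [Nat.add_sub_cancel, Measure.euclideanHausdorffMeasure_def, Measure.smul_apply,
    ENNReal.smul_def, smul_eq_mul]
  exact ENNReal.mul_pos (by
    exact_mod_cast Measure.addHaarScalarFactor_volume_hausdorffMeasure_ne_zero m) h4.ne'

namespace Mesh

variable {n : ℕ} {Γ : Set (E n)} (M : Mesh Γ)

/-- The relative interior of an element. -/
def inner (i : Fin M.card) : Set (E n) := M.F i '' openSimplex n

theorem isCompact_elem (i : Fin M.card) : IsCompact (M.elem i) :=
  (isCompact_stdSimplex ℝ (Fin n)).image_of_continuousOn (M.continuousOn i)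

theorem isCompact_bdry (i : Fin M.card) : IsCompact (M.bdry i) := by
  have hc : IsClosed {x : Fin n → ℝ | ∃ k, x k = 0} := by
    simp only [ofPred_exists]
    exact isClosed_iUnion_of_finite fun k => isClosed_eq (continuous_apply k) continuous_const
  exact ((isCompact_stdSimplex ℝ (Fin n)).inter_right hc).image_of_continuousOn
    ((M.continuousOn i).mono inter_subset_left)

theorem elem_subset (i : Fin M.card) : M.elem i ⊆ Γ :=
  (subset_iUnion (fun i => M.F i '' stdSimplex ℝ (Fin n)) i).trans M.cover.subset

theorem inner_subset_elem (i : Fin M.card) : M.inner i ⊆ M.elem i :=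
  image_mono fun _ h => h.1

theorem bdry_subset_elem (i : Fin M.card) : M.bdry i ⊆ M.elem i :=
  image_mono fun _ h => h.1

theorem inner_eq (i : Fin M.card) : M.inner i = M.elem i \ M.bdry i := by
  ext y
  constructor
  · rintro ⟨x, hx, rfl⟩
    refine ⟨⟨x, hx.1, rfl⟩, ?_⟩
    rintro ⟨z, ⟨hz, k, hk⟩, hzx⟩
    have := M.injOn i hz hx.1 hzx
    subst this
    exact (hx.2 k).ne' hk
  · rintro ⟨⟨x, hx, rfl⟩, hb⟩
    refine ⟨x, ⟨hx, fun k => ?_⟩, rfl⟩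
    refine lt_of_le_of_ne (hx.1 k) fun h => hb ⟨x, ⟨hx, k, h.symm⟩, rfl⟩

theorem measurableSet_inner (i : Fin M.card) : MeasurableSet (M.inner i) := by
  rw [inner_eq]
  exact (M.isCompact_elem i).measurableSet.diff (M.isCompact_bdry i).measurableSet

theorem disjoint_inner {i j : Fin M.card} (h : i ≠ j) : Disjoint (M.inner i) (M.inner j) :=
  (M.disjoint i j h).mono_right (M.inner_subset_elem j)

theorem diam_elem_le_size (i : Fin M.card) : Metric.diam (M.elem i) ≤ M.size :=
  le_ciSup (f := fun i => Metric.diam (M.elem i)) (Set.finite_range _).bddAbove i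

theorem dist_le_size {i : Fin M.card} {x y : E n} (hx : x ∈ M.elem i) (hy : y ∈ M.elem i) :
    dist x y ≤ M.size :=
  (Metric.dist_le_diam_of_mem (M.isCompact_elem i).isBounded hx hy).trans (M.diam_elem_le_size i)

theorem vertex_mem_elem (i : Fin M.card) (k : Fin n) : M.F i (Pi.single k 1) ∈ M.elem i :=
  ⟨_, single_mem_stdSimplex ℝ k, rfl⟩

theorem vertex_mem_bdry (hn : 2 ≤ n) (i : Fin M.card) (k : Fin n) :
    M.F i (Pi.single k 1) ∈ M.bdry i := by
  have : Nontrivial (Fin n) := Fin.nontrivial_iff_two_le.2 hn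
  obtain ⟨l, hl⟩ := exists_ne k
  exact ⟨_, ⟨single_mem_stdSimplex ℝ k, l, Pi.single_eq_of_ne hl 1⟩, rfl⟩

theorem size_pos (hn : 2 ≤ n) (i : Fin M.card) : 0 < M.size := by
  have : Nontrivial (Fin n) := Fin.nontrivial_iff_two_le.2 hn
  obtain ⟨k, l, hkl⟩ := exists_pair_ne (Fin n)
  refine lt_of_lt_of_le (dist_pos.2 ?_) (M.dist_le_size (M.vertex_mem_elem i k) (M.vertex_mem_elem i l))
  intro h
  have h1 := congrFun (M.injOn i (single_mem_stdSimplex ℝ k) (single_mem_stdSimplex ℝ l) h) k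
  rw [Pi.single_eq_same, Pi.single_eq_of_ne hkl] at h1
  exact one_ne_zero h1

theorem size_le_diam (hΓ : Bornology.IsBounded Γ) : M.size ≤ Metric.diam Γ :=
  Real.iSup_le (fun i => Metric.diam_mono (M.elem_subset i) hΓ) Metric.diam_nonneg

theorem mem_nodes {y : E n} : y ∈ M.nodes ↔ ∃ i k, M.F i (Pi.single k 1) = y := by
  simp [nodes]

theorem mem_patch {y t : E n} : t ∈ M.patch y ↔ ∃ i, y ∈ M.bdry i ∧ t ∈ M.elem i := by
  simp [patch]

theorem isClosed_patch (y : E n) : IsClosed (M.patch y) :=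
  isClosed_iUnion_of_finite fun i => isClosed_iUnion_of_finite fun _ => (M.isCompact_elem i).isClosed

theorem dist_le_of_mem_patch {y t : E n} (ht : t ∈ M.patch y) : dist t y ≤ M.size := by
  obtain ⟨i, hy, hi⟩ := M.mem_patch.1 ht
  exact M.dist_le_size hi (M.bdry_subset_elem i hy)

theorem exists_elem_subset_patch (hn : 2 ≤ n) {y : E n} (hy : y ∈ M.nodes) :
    ∃ i, M.elem i ⊆ M.patch y := by
  obtain ⟨i, k, rfl⟩ := M.mem_nodes.1 hy
  exact ⟨i, fun t ht => M.mem_patch.2 ⟨i, M.vertex_mem_bdry hn i k, ht⟩⟩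

/-- Shape regularity and quasi-uniformity make the inverse parametrization Lipschitz with constant
`κ² / h`, so the fixed positive measure of the open simplex is at most `(κ² / h)^(n-1)` times that
of the element. -/
theorem exists_measure_inner_ge (hn : 2 ≤ n) {κ : ℝ} (hκ : 0 < κ) :
    ∃ c : ℝ≥0, 0 < c ∧ ∀ (Γ : Set (E n)) (M : Mesh Γ), M.IsShapeRegular κ → M.IsQuasiUniform κ →
      ∀ i, c * ENNReal.ofReal M.size ^ (n - 1) ≤ surfaceMeasure Γ (M.inner i) := by
  obtain ⟨c, hc0, hc⟩ := ENNReal.lt_iff_exists_nnreal_btwn.1 (measure_openSimplex_pos hn)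
  have hc0' : 0 < c := by exact_mod_cast hc0
  set k : ℝ≥0 := (Real.toNNReal (κ ^ 2)) with hk
  have hk0 : 0 < k := Real.toNNReal_pos.2 (by positivity)
  refine ⟨c / k ^ (n - 1), by positivity, fun Γ M hS hQ i => ?_⟩
  have hh := M.size_pos hn i
  rw [surfaceMeasure, Measure.restrict_eq_self _ ((M.inner_subset_elem i).trans (M.elem_subset i))]
  set h : ℝ≥0 := Real.toNNReal M.size with hhdef
  have hh0 : 0 < h := Real.toNNReal_pos.2 hh
  have hinv : LipschitzOnWith (k / h) (Function.invFunOn (M.F i) (openSimplex n)) (M.inner i) := by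
    refine LipschitzOnWith.of_dist_le_mul ?_
    rintro x ⟨x', hx', rfl⟩ y ⟨y', hy', rfl⟩
    have hinj : InjOn (M.F i) (openSimplex n) := (M.injOn i).mono fun _ h => h.1
    rw [hinj.leftInvOn_invFunOn hx', hinj.leftInvOn_invFunOn hy']
    have h1 := (hS i x' hx'.1 y' hy'.1).1
    have h2 := hQ i
    rw [NNReal.coe_div, hk, hhdef, Real.coe_toNNReal _ (by positivity), Real.coe_toNNReal _ hh.le,
      div_mul_eq_mul_div, le_div_iff₀ hh]
    calc dist x' y' * M.size ≤ dist x' y' * (κ * Metric.diam (M.elem i)) := by gcongr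
      _ = κ ^ 2 * (κ⁻¹ * Metric.diam (M.elem i) * dist x' y') := by field_simp
      _ ≤ κ ^ 2 * dist (M.F i x') (M.F i y') := by gcongr
  have himg : openSimplex n ⊆ Function.invFunOn (M.F i) (openSimplex n) '' M.inner i := by
    intro x hx
    have hinj : InjOn (M.F i) (openSimplex n) := (M.injOn i).mono fun _ h => h.1
    exact ⟨M.F i x, ⟨x, hx, rfl⟩, hinj.leftInvOn_invFunOn hx⟩
  have h3 := hc.le.trans ((measure_mono himg).trans
    (hinv.euclideanHausdorffMeasure_image_le (n - 1)))
  rw [ENNReal.ofReal, ← hhdef, ENNReal.coe_div (by positivity), ENNReal.coe_pow]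
  rw [← ENNReal.coe_pow, div_pow, ENNReal.coe_div (by positivity), ENNReal.coe_pow,
    ENNReal.coe_pow] at h3
  have hkn : (k : ℝ≥0∞) ^ (n - 1) ≠ 0 := by positivity
  have hkt : (k : ℝ≥0∞) ^ (n - 1) ≠ ∞ := by finiteness
  have hhn : (h : ℝ≥0∞) ^ (n - 1) ≠ 0 := by positivity
  have hht : (h : ℝ≥0∞) ^ (n - 1) ≠ ∞ := by finiteness
  rw [mul_comm, ← mul_div_assoc, ENNReal.div_le_iff hkn hkt, mul_comm]
  calc (c : ℝ≥0∞) * (h : ℝ≥0∞) ^ (n - 1)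
      ≤ (k : ℝ≥0∞) ^ (n - 1) / (h : ℝ≥0∞) ^ (n - 1) * μHE[n - 1] (M.inner i) *
        (h : ℝ≥0∞) ^ (n - 1) := by gcongr
    _ = μHE[n - 1] (M.inner i) * (k : ℝ≥0∞) ^ (n - 1) := by
        rw [mul_right_comm, ENNReal.div_mul_cancel hhn hht, mul_comm]

-- A packing argument: if `t` lies in the patch of `y`, any element with vertex `y` lies in the ball
-- of radius `2h` about `t`. Disjoint interiors of measure at least `c h^(n-1)` leave room for at
-- most `A 2^(n-1) / c` such elements, each with `n` vertices. Conformity of the mesh plays no role.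
open Classical in
theorem exists_patch_bounds (hn : 2 ≤ n) {κ : ℝ} (hκ : 0 < κ) {Γ : Set (E n)} {A : ℝ≥0}
    (hA : ∀ (x : E n) (r : ℝ), 0 ≤ r →
      surfaceMeasure Γ (Metric.closedBall x r) ≤ A * ENNReal.ofReal r ^ (n - 1)) :
    ∃ (N : ℕ) (c : ℝ≥0), 0 < c ∧ ∀ M : Mesh Γ, M.IsShapeRegular κ → M.IsQuasiUniform κ →
      (∀ t, (M.nodes.filter fun y => t ∈ M.patch y).card ≤ N) ∧
      ∀ y ∈ M.nodes, c * ENNReal.ofReal M.size ^ (n - 1) ≤ surfaceMeasure Γ (M.patch y) := by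
  obtain ⟨c, hc, hcM⟩ := exists_measure_inner_ge hn hκ
  refine ⟨⌊A * 2 ^ (n - 1) / c⌋₊ * n, c, hc, fun M hS hQ => ⟨fun t => ?_, fun y hy => ?_⟩⟩
  swap
  · obtain ⟨i, hi⟩ := M.exists_elem_subset_patch hn hy
    exact (hcM Γ M hS hQ i).trans (measure_mono ((M.inner_subset_elem i).trans hi))
  set S : Finset (Fin M.card) := Finset.univ.filter fun i =>
    M.elem i ⊆ Metric.closedBall t (2 * M.size) with hSdef
  have hsub : (M.nodes.filter fun y => t ∈ M.patch y) ⊆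
      (S ×ˢ (Finset.univ : Finset (Fin n))).image fun p => M.F p.1 (Pi.single p.2 1) := by
    intro y hy
    obtain ⟨hy, ht⟩ := Finset.mem_filter.1 hy
    obtain ⟨i, k, rfl⟩ := M.mem_nodes.1 hy
    refine Finset.mem_image.2 ⟨(i, k), ?_, rfl⟩
    simp only [hSdef, Finset.mem_product, Finset.mem_filter, Finset.mem_univ, true_and, and_true]
    intro z hz
    have h1 := M.dist_le_of_mem_patch ht
    have h2 := M.dist_le_size hz (M.vertex_mem_elem i k)
    have h3 := dist_triangle_right z t (M.F i (Pi.single k 1))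
    rw [Metric.mem_closedBall]
    linarith
  have hcard : (S.card : ℝ≥0) ≤ A * 2 ^ (n - 1) / c := by
    rcases S.eq_empty_or_nonempty with h0 | ⟨i, -⟩
    · simp [h0]
    have hh := M.size_pos hn i
    have h1 : ∑ i ∈ S, surfaceMeasure Γ (M.inner i) ≤
        surfaceMeasure Γ (Metric.closedBall t (2 * M.size)) := by
      rw [← measure_biUnion_finset (fun i _ j _ hij => M.disjoint_inner hij)
        fun i _ => M.measurableSet_inner i]
      exact measure_mono (iUnion₂_subset fun i hi =>
        (M.inner_subset_elem i).trans (Finset.mem_filter.1 hi).2)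
    have h2 := (Finset.sum_le_sum fun i _ => hcM Γ M hS hQ i).trans
      (h1.trans (hA t _ (by positivity)))
    rw [Finset.sum_const, nsmul_eq_mul, ENNReal.ofReal_mul (by norm_num), mul_pow,
      ← mul_assoc, ← mul_assoc, ENNReal.mul_le_mul_iff_left
        (pow_ne_zero _ (ENNReal.ofReal_pos.2 hh).ne') (by finiteness)] at h2
    rw [le_div_iff₀ hc]
    rw [ENNReal.ofReal_ofNat] at h2
    exact_mod_cast h2
  calc _ ≤ _ := Finset.card_le_card hsub
    _ ≤ _ := Finset.card_image_le
    _ = S.card * n := by simp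
    _ ≤ _ := Nat.mul_le_mul_right _ (Nat.le_floor hcard)

end Mesh

/-! ### Estimates for the Gagliardo seminorm -/

/-- The integrand of the Gagliardo seminorm. -/
def gagKernel {n : ℕ} (v : E n → ℝ) (t s : E n) : ℝ≥0∞ := ‖v t - v s‖ₑ ^ 2 / edist t s ^ n

theorem gagKernel_comm {n : ℕ} (v : E n → ℝ) (t s : E n) : gagKernel v t s = gagKernel v s t := by
  rw [gagKernel, gagKernel, enorm_sub_rev, edist_comm]

theorem seminormSq_eq {n : ℕ} (τ : Set (E n)) (v : E n → ℝ) : seminormSq τ v =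
    ∫⁻ t, ∫⁻ s, gagKernel v t s ∂(surfaceMeasure τ) ∂(surfaceMeasure τ) := rfl

theorem measurable_gagKernel {n : ℕ} {v : E n → ℝ} (hv : Measurable v) :
    Measurable fun p : E n × E n => gagKernel v p.1 p.2 := by
  unfold gagKernel
  exact (((hv.comp measurable_fst).sub (hv.comp measurable_snd)).enorm.pow_const 2).div
      ((measurable_fst.edist measurable_snd).pow_const n)

theorem measurable_gagKernel_right {n : ℕ} {v : E n → ℝ} (hv : Measurable v) (t : E n) :
    Measurable fun s : E n => gagKernel v t s :=
  ((measurable_const.sub hv).enorm.pow_const 2).div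
    ((measurable_const.edist measurable_id).pow_const n)

section

variable {n : ℕ} {μ : Measure (E n)}

/-- A dyadic shell at distance `r` contributes about `r^(n-1) (r/h)² r^(-n) = r / h²` if `r ≤ h`,
and `r^(n-1) r^(-n) = 1 / r` if `r ≥ h`. Both are geometric series with sum of order `1 / h`. -/
theorem lintegral_truncated_kernel_le (hn : 2 ≤ n) {A : ℝ≥0}
    (hA : ∀ (x : E n) (r : ℝ), 0 ≤ r → μ (Metric.closedBall x r) ≤ A * ENNReal.ofReal r ^ (n - 1))
    {h : ℝ} (hh : 0 < h) (t : E n) :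
    ∫⁻ s, ENNReal.ofReal (min 1 (dist t s / h)) ^ 2 / edist t s ^ n ∂μ ≤
      A * 2 ^ (n + 2) / ENNReal.ofReal h := by
  obtain ⟨m, rfl⟩ : ∃ m, n = m + 1 := ⟨n - 1, by omega⟩
  rw [Nat.add_sub_cancel] at hA
  -- `a k` bounds the integrand at distances from `2^(-k-1) h` to `2^(-k) h`, and `b k` from `2^k h`
  -- to `2^(k+1) h`; shells are enlarged to the balls `P k` and `Q k`.
  set a : ℕ → ℝ := fun k => ((1 / 2) ^ k) ^ 2 / ((1 / 2) ^ (k + 1) * h) ^ (m + 1) with ha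
  set b : ℕ → ℝ := fun k => 1 / (2 ^ k * h) ^ (m + 1) with hb
  set P : ℕ → Set (E (m + 1)) := fun k => Metric.closedBall t ((1 / 2) ^ k * h) with hP
  set Q : ℕ → Set (E (m + 1)) := fun k => Metric.closedBall t (2 ^ (k + 1) * h) with hQ
  have hpt : ∀ s, ENNReal.ofReal (min 1 (dist t s / h)) ^ 2 / edist t s ^ (m + 1) ≤
      ∑' k, ((P k).indicator (fun _ => ENNReal.ofReal (a k)) s +
        (Q k).indicator (fun _ => ENNReal.ofReal (b k)) s) := by
    intro s
    rcases eq_or_ne t s with rfl | hts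
    · simp
    have hd : 0 < dist t s := dist_pos.2 hts
    have hx : 0 < dist t s / h := by positivity
    have hdx : dist t s = dist t s / h * h := by field_simp
    have hform : ENNReal.ofReal (min 1 (dist t s / h)) ^ 2 / edist t s ^ (m + 1) =
        ENNReal.ofReal (min 1 (dist t s / h) ^ 2 / dist t s ^ (m + 1)) := by
      rw [edist_dist, ENNReal.ofReal_div_of_pos (by positivity), ENNReal.ofReal_pow (by positivity),
        ENNReal.ofReal_pow (by positivity)]
    rw [hform]
    rcases le_total (dist t s / h) 1 with hle | hle
    · obtain ⟨k, hk1, hk2⟩ := exists_nat_pow_near_of_lt_one hx hle (y := (1 / 2 : ℝ))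
        (by norm_num) (by norm_num)
      refine le_trans ?_ (ENNReal.le_tsum k)
      refine le_trans ?_ le_self_add
      have hmem : s ∈ P k := by
        rw [hP, Metric.mem_closedBall', hdx]; gcongr
      rw [indicator_of_mem hmem, min_eq_right hle]
      refine ENNReal.ofReal_le_ofReal ?_
      rw [ha]
      have : (1 / 2) ^ (k + 1) * h ≤ dist t s := by rw [hdx]; gcongr
      dsimp only
      gcongr
    · obtain ⟨k, hk1, hk2⟩ := exists_nat_pow_near hle (y := (2 : ℝ)) (by norm_num)
      refine le_trans ?_ (ENNReal.le_tsum k)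
      refine le_trans ?_ le_add_self
      have hmem : s ∈ Q k := by
        rw [hQ, Metric.mem_closedBall', hdx]; gcongr
      rw [indicator_of_mem hmem, min_eq_left hle, one_pow]
      refine ENNReal.ofReal_le_ofReal ?_
      have : 2 ^ k * h ≤ dist t s := by rw [hdx]; gcongr
      rw [hb]
      dsimp only
      gcongr
  refine (lintegral_mono hpt).trans ?_
  have hPm : ∀ k, MeasurableSet (P k) := fun k => measurableSet_closedBall
  have hQm : ∀ k, MeasurableSet (Q k) := fun k => measurableSet_closedBall
  have hmeas : ∀ k, Measurable fun s => (P k).indicator (fun _ => ENNReal.ofReal (a k)) s +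
      (Q k).indicator (fun _ => ENNReal.ofReal (b k)) s := fun k =>
    (measurable_const.indicator (hPm k)).add (measurable_const.indicator (hQm k))
  rw [lintegral_tsum fun k => (hmeas k).aemeasurable]
  have hterm : ∀ k, ∫⁻ s, ((P k).indicator (fun _ => ENNReal.ofReal (a k)) s +
        (Q k).indicator (fun _ => ENNReal.ofReal (b k)) s) ∂μ ≤
      A * ENNReal.ofReal (2 ^ (m + 2) / h * (1 / 2) ^ k) := by
    intro k
    rw [lintegral_add_left (measurable_const.indicator (hPm k)), lintegral_indicator_const (hPm k),
      lintegral_indicator_const (hQm k)]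
    have h1 := hA t ((1 / 2) ^ k * h) (by positivity)
    have h2 := hA t (2 ^ (k + 1) * h) (by positivity)
    have ha0 : 0 ≤ a k := by positivity
    have hb0 : 0 ≤ b k := by positivity
    calc _ ≤ ENNReal.ofReal (a k) * (A * ENNReal.ofReal ((1 / 2) ^ k * h) ^ m) +
          ENNReal.ofReal (b k) * (A * ENNReal.ofReal (2 ^ (k + 1) * h) ^ m) := by gcongr
      _ = A * ENNReal.ofReal (a k * ((1 / 2) ^ k * h) ^ m + b k * (2 ^ (k + 1) * h) ^ m) := by
          rw [ENNReal.ofReal_add (by positivity) (by positivity), ENNReal.ofReal_mul ha0,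
            ENNReal.ofReal_mul hb0, ENNReal.ofReal_pow (by positivity),
            ENNReal.ofReal_pow (by positivity)]
          ring
      _ ≤ _ := by
          gcongr
          have e1 : a k * ((1 / 2) ^ k * h) ^ m = 2 ^ (m + 1) / h * (1 / 2) ^ k := by
            have hq : (0 : ℝ) < (1 / 2) ^ k := by positivity
            simp only [ha, pow_succ (1 / 2 : ℝ) k]
            generalize (1 / 2 : ℝ) ^ k = q at hq
            rw [show q * (1 / 2) * h = q * h / 2 by ring, div_pow]
            field_simp
            ring
          have e2 : b k * (2 ^ (k + 1) * h) ^ m = 2 ^ m / h * (1 / 2) ^ k := by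
            simp only [hb, one_div, inv_pow]; field_simp; ring
          have e3 : (2 : ℝ) ^ m / h * (1 / 2) ^ k ≤ 2 ^ (m + 1) / h * (1 / 2) ^ k := by
            gcongr <;> norm_num
          rw [e1, e2]
          calc _ ≤ 2 ^ (m + 1) / h * (1 / 2) ^ k + 2 ^ (m + 1) / h * (1 / 2) ^ k := by linarith
            _ = _ := by ring
  refine (ENNReal.tsum_le_tsum hterm).trans ?_
  rw [ENNReal.tsum_mul_left, ← ENNReal.ofReal_tsum_of_nonneg (fun k => by positivity)
    (summable_geometric_two.mul_left _), tsum_mul_left, tsum_geometric_two, mul_div_assoc]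
  gcongr
  rw [← ENNReal.ofReal_ofNat, ← ENNReal.ofReal_pow (by norm_num), ← ENNReal.ofReal_div_of_pos hh]
  refine ENNReal.ofReal_le_ofReal (le_of_eq ?_)
  ring

/-- Poincaré inequality with a value `v s` in place of the mean: some `s` does no worse than the
average over `S`, and on `S × S` the numerator is at most `d ^ n` times the kernel. -/
theorem exists_lintegral_sub_sq_le [SFinite μ] {v : E n → ℝ} (hv : Measurable v) {S : Set (E n)}
    (hS : MeasurableSet S) (h0 : μ S ≠ 0) (ht : μ S ≠ ∞) {d : ℝ≥0∞} (hdt : d ≠ ∞)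
    (hd : ∀ x ∈ S, ∀ y ∈ S, edist x y ≤ d) :
    ∃ c : ℝ, ∫⁻ t in S, ‖v t - c‖ₑ ^ 2 ∂μ ≤
      d ^ n / μ S * ∫⁻ t in S, ∫⁻ s in S, gagKernel v t s ∂μ ∂μ := by
  have hm : Measurable fun p : E n × E n => ‖v p.2 - v p.1‖ₑ ^ 2 :=
    ((hv.comp measurable_snd).sub (hv.comp measurable_fst)).enorm.pow_const 2
  obtain ⟨s, hs, hle⟩ := exists_le_setLAverage h0 ht
    (f := fun s => ∫⁻ t in S, ‖v t - v s‖ₑ ^ 2 ∂μ) (hm.lintegral_prod_right').aemeasurable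
  refine ⟨v s, hle.trans ?_⟩
  have hdn : d ^ n ≠ ∞ := ENNReal.pow_ne_top hdt
  rw [setLAverage_eq, div_eq_mul_inv, div_eq_mul_inv, mul_right_comm,
    ← lintegral_const_mul' _ _ hdn]
  refine mul_le_mul' ?_ le_rfl
  refine setLIntegral_mono' hS fun x hx => ?_
  rw [← lintegral_const_mul' _ _ hdn]
  refine setLIntegral_mono' hS fun y hy => ?_
  rcases eq_or_ne x y with rfl | hxy
  · simp
  rw [gagKernel_comm, gagKernel]
  have h1 : edist y x ^ n ≠ 0 := pow_ne_zero _ (edist_pos.2 hxy.symm).ne'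
  have h2 : edist y x ^ n ≠ ∞ := ENNReal.pow_ne_top (edist_ne_top _ _)
  calc ‖v y - v x‖ₑ ^ 2 = edist y x ^ n * (‖v y - v x‖ₑ ^ 2 / edist y x ^ n) :=
        (ENNReal.mul_div_cancel h1 h2).symm
    _ ≤ _ := by gcongr; exact hd y hy x hx

/-- The kernel vanishes when both points are outside `S`, and by symmetry the two mixed regions
contribute equally. -/
theorem lintegral_gagKernel_le_of_support [SFinite μ] {v : E n → ℝ} (hv : Measurable v)
    {S : Set (E n)} (hS : MeasurableSet S) (h0 : ∀ᵐ s ∂μ, s ∉ S → v s = 0) :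
    ∫⁻ t, ∫⁻ s, gagKernel v t s ∂μ ∂μ ≤ 2 * ∫⁻ t in S, ∫⁻ s, gagKernel v t s ∂μ ∂μ := by
  have hk := measurable_gagKernel hv
  rw [← lintegral_add_compl _ hS, two_mul]
  refine add_le_add le_rfl ?_
  have h1 : ∫⁻ t in Sᶜ, ∫⁻ s, gagKernel v t s ∂μ ∂μ ≤
      ∫⁻ t in Sᶜ, ∫⁻ s in S, gagKernel v t s ∂μ ∂μ := by
    refine lintegral_mono_ae ?_
    filter_upwards [ae_restrict_of_ae h0, ae_restrict_mem hS.compl] with t ht htS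
    rw [← lintegral_add_compl _ hS]
    refine (add_le_add le_rfl (le_of_eq ?_)).trans (add_zero _).le
    refine lintegral_eq_zero_of_ae_eq_zero ?_
    filter_upwards [ae_restrict_of_ae h0, ae_restrict_mem hS.compl] with s hs hsS
    simp [gagKernel, ht htS, hs hsS]
  refine h1.trans ?_
  rw [lintegral_lintegral_swap hk.aemeasurable]
  refine lintegral_mono fun s => ?_
  refine (lintegral_mono' Measure.restrict_le_self le_rfl).trans (le_of_eq ?_)
  exact lintegral_congr fun t => gagKernel_comm v t s

/-- The product rule `φ t (v t - c) - φ s (v s - c) = φ s (v t - v s) + (v t - c) (φ t - φ s)`. The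
factor `v - c` appears at `t` only, so the `s`-integral of the second term is the truncated kernel.
-/
theorem gagKernel_mul_le {φ v : E n → ℝ} {B c h : ℝ} {t s : E n}
    (hs : |φ s| ≤ B) (hts : |φ t - φ s| ≤ B * min 1 (dist t s / h)) (hh : 0 < h) :
    gagKernel (fun x => φ x * (v x - c)) t s ≤ ENNReal.ofReal (2 * B ^ 2) *
      (gagKernel v t s + ‖v t - c‖ₑ ^ 2 *
        (ENNReal.ofReal (min 1 (dist t s / h)) ^ 2 / edist t s ^ n)) := by
  rw [gagKernel, gagKernel, ← mul_div_assoc, ← ENNReal.add_div, ← mul_div_assoc]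
  gcongr
  set m := min 1 (dist t s / h)
  have hm : 0 ≤ m := by positivity
  rw [Real.enorm_eq_ofReal_abs, Real.enorm_eq_ofReal_abs, Real.enorm_eq_ofReal_abs,
    ← ENNReal.ofReal_pow (abs_nonneg _), ← ENNReal.ofReal_pow (abs_nonneg _),
    ← ENNReal.ofReal_pow (abs_nonneg _), ← ENNReal.ofReal_pow hm,
    ← ENNReal.ofReal_mul (by positivity), ← ENNReal.ofReal_add (by positivity) (by positivity),
    ← ENNReal.ofReal_mul (by positivity)]
  refine ENNReal.ofReal_le_ofReal ?_
  simp only [sq_abs]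
  have e : φ t * (v t - c) - φ s * (v s - c) =
    φ s * (v t - v s) + (v t - c) * (φ t - φ s) := by ring
  have h1 : φ s ^ 2 ≤ B ^ 2 := sq_le_sq' (by linarith [abs_le.1 hs]) (abs_le.1 hs).2
  have h2 : (φ t - φ s) ^ 2 ≤ (B * m) ^ 2 :=
    sq_le_sq' (by linarith [abs_le.1 hts]) (abs_le.1 hts).2
  rw [e]
  calc _ ≤ 2 * ((φ s * (v t - v s)) ^ 2 + ((v t - c) * (φ t - φ s)) ^ 2) := add_sq_le
    _ = 2 * (φ s ^ 2 * (v t - v s) ^ 2 + (v t - c) ^ 2 * (φ t - φ s) ^ 2) := by ring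
    _ ≤ 2 * (B ^ 2 * (v t - v s) ^ 2 + (v t - c) ^ 2 * (B * m) ^ 2) := by gcongr
    _ = _ := by ring

theorem exists_cutoff_seminorm_le [IsFiniteMeasure μ] (hn : 2 ≤ n) {A c : ℝ≥0} (hc : 0 < c)
    (hA : ∀ (x : E n) (r : ℝ), 0 ≤ r → μ (Metric.closedBall x r) ≤ A * ENNReal.ofReal r ^ (n - 1))
    {h : ℝ} (hh : 0 < h) {S : Set (E n)} (hS : MeasurableSet S)
    (hSd : ∀ x ∈ S, ∀ y ∈ S, dist x y ≤ 2 * h) (hSμ : c * ENNReal.ofReal h ^ (n - 1) ≤ μ S)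
    {B : ℝ} {φ : E n → ℝ} (hφ : Measurable φ) (hφ0 : ∀ᵐ s ∂μ, s ∉ S → φ s = 0)
    (hφB : ∀ᵐ s ∂μ, |φ s| ≤ B)
    (hφL : ∀ᵐ t ∂μ, ∀ᵐ s ∂μ, |φ t - φ s| ≤ B * min 1 (dist t s / h))
    {v : E n → ℝ} (hv : Measurable v) :
    ∃ a : ℝ, ∫⁻ t, ∫⁻ s, gagKernel (fun x => φ x * (v x - a)) t s ∂μ ∂μ ≤
      2 * (ENNReal.ofReal (2 * B ^ 2) * (1 + A * 2 ^ (n + 2) * 2 ^ n / c)) *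
        ∫⁻ t in S, ∫⁻ s, gagKernel v t s ∂μ ∂μ := by
  have hho : ENNReal.ofReal h ≠ 0 := (ENNReal.ofReal_pos.2 hh).ne'
  have hpos : 0 < c * ENNReal.ofReal h ^ (n - 1) := by positivity
  obtain ⟨a, ha⟩ := exists_lintegral_sub_sq_le hv hS (hpos.trans_le hSμ).ne' (measure_ne_top _ _)
    (d := ENNReal.ofReal (2 * h)) ENNReal.ofReal_ne_top (fun x hx y hy => by
      rw [edist_dist]; exact ENNReal.ofReal_le_ofReal (hSd x hx y hy))
  refine ⟨a, ?_⟩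
  set I := ∫⁻ t in S, ∫⁻ s, gagKernel v t s ∂μ ∂μ with hI
  -- The factor `h` is `d ^ n / μ S` with `d = 2h` and `μ S ≥ c h^(n-1)`; it cancels the `1 / h` in
  -- `T`.
  have hL2 : ∫⁻ t in S, ‖v t - a‖ₑ ^ 2 ∂μ ≤ 2 ^ n * ENNReal.ofReal h / c * I := by
    refine ha.trans ?_
    have h1 : ∫⁻ t in S, ∫⁻ s in S, gagKernel v t s ∂μ ∂μ ≤ I :=
      lintegral_mono fun t => lintegral_mono' Measure.restrict_le_self le_rfl
    refine mul_le_mul' ?_ h1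
    have h2 : ENNReal.ofReal (2 * h) ^ n = 2 ^ n * ENNReal.ofReal h *
        ENNReal.ofReal h ^ (n - 1) := by
      rw [ENNReal.ofReal_mul (by norm_num), mul_pow, ENNReal.ofReal_ofNat, mul_assoc, ← pow_succ',
        Nat.sub_add_cancel (by omega)]
    rw [h2]
    calc _ ≤ 2 ^ n * ENNReal.ofReal h * ENNReal.ofReal h ^ (n - 1) /
          (c * ENNReal.ofReal h ^ (n - 1)) := by gcongr
      _ = _ := ENNReal.mul_div_mul_right _ _ (pow_ne_zero _ hho) (by finiteness)
  have hk := measurable_gagKernel hv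
  have hw : Measurable fun x => φ x * (v x - a) := hφ.mul (hv.sub_const a)
  refine (lintegral_gagKernel_le_of_support hw hS ?_).trans ?_
  · filter_upwards [hφ0] with s hs hsS
    rw [hs hsS, zero_mul]
  rw [mul_assoc]
  gcongr
  set C := ENNReal.ofReal (2 * B ^ 2)
  have hC : C ≠ ∞ := ENNReal.ofReal_ne_top
  set T := A * 2 ^ (n + 2) / ENNReal.ofReal h with hT
  have hin : ∀ᵐ t ∂μ, ∫⁻ s, gagKernel (fun x => φ x * (v x - a)) t s ∂μ ≤
      C * (∫⁻ s, gagKernel v t s ∂μ + ‖v t - a‖ₑ ^ 2 * T) := by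
    filter_upwards [hφL] with t ht
    have h1 : ∫⁻ s, gagKernel (fun x => φ x * (v x - a)) t s ∂μ ≤ ∫⁻ s, C *
      (gagKernel v t s + ‖v t - a‖ₑ ^ 2 *
        (ENNReal.ofReal (min 1 (dist t s / h)) ^ 2 / edist t s ^ n)) ∂μ := by
      refine lintegral_mono_ae ?_
      filter_upwards [ht, hφB] with s hts hs
      exact gagKernel_mul_le hs hts hh
    refine h1.trans ?_
    rw [lintegral_const_mul' _ _ hC, lintegral_add_left (measurable_gagKernel_right hv t),
      lintegral_const_mul' _ _ (by finiteness)]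
    gcongr
    exact lintegral_truncated_kernel_le hn hA hh t
  refine (lintegral_mono_ae (ae_restrict_of_ae hin)).trans ?_
  rw [lintegral_const_mul' _ _ hC, lintegral_add_left hk.lintegral_prod_right',
    lintegral_mul_const _ (((hv.sub_const a).enorm).pow_const 2), mul_assoc, add_mul, one_mul]
  refine mul_le_mul' le_rfl (add_le_add le_rfl ?_)
  calc _ ≤ 2 ^ n * ENNReal.ofReal h / c * I * T := by gcongr
    _ = _ := by
      rw [hT]
      simp only [div_eq_mul_inv]
      calc _ = (ENNReal.ofReal h * (ENNReal.ofReal h)⁻¹) *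
            (A * 2 ^ (n + 2) * 2 ^ n * (c : ℝ≥0∞)⁻¹ * I) := by ring
        _ = _ := by rw [ENNReal.mul_inv_cancel hho ENNReal.ofReal_ne_top, one_mul]

open Classical in
theorem sum_setLIntegral_le {X ι : Type*} [MeasurableSpace X] {μ : Measure X} (s : Finset ι)
    {S : ι → Set X} (hS : ∀ i ∈ s, MeasurableSet (S i)) {N : ℕ}
    (hN : ∀ t, (s.filter fun i => t ∈ S i).card ≤ N) {f : X → ℝ≥0∞} (hf : Measurable f) :
    ∑ i ∈ s, ∫⁻ t in S i, f t ∂μ ≤ N * ∫⁻ t, f t ∂μ := by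
  calc _ = ∑ i ∈ s, ∫⁻ t, (S i).indicator f t ∂μ :=
        Finset.sum_congr rfl fun i hi => (lintegral_indicator (hS i hi) f).symm
    _ = ∫⁻ t, ∑ i ∈ s, (S i).indicator f t ∂μ :=
        (lintegral_finsetSum' s fun i hi => (hf.indicator (hS i hi)).aemeasurable).symm
    _ ≤ ∫⁻ t, N * f t ∂μ := by
        refine lintegral_mono fun t => ?_
        simp only [indicator_apply]
        rw [← Finset.sum_filter, Finset.sum_const, nsmul_eq_mul]
        gcongr
        exact_mod_cast hN t
    _ = _ := lintegral_const_mul _ hf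

-- At a pair `(t, s)` at most `2N` differences `v i t - v i s` are nonzero, `N` from each point;
-- Cauchy–Schwarz over these indices gives the factor `2N`.
open Classical in
theorem lintegral_gagKernel_sum_le [SFinite μ] {ι : Type*} (I : Finset ι) {v : ι → E n → ℝ}
    (hv : ∀ i ∈ I, Measurable (v i)) {N : ℕ}
    (hN : ∀ᵐ t ∂μ, (I.filter fun i => v i t ≠ 0).card ≤ N) :
    ∫⁻ t, ∫⁻ s, gagKernel (fun x => ∑ i ∈ I, v i x) t s ∂μ ∂μ ≤
      (2 * N : ℕ) * ∑ i ∈ I, ∫⁻ t, ∫⁻ s, gagKernel (v i) t s ∂μ ∂μ := by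
  have hk := fun i hi => measurable_gagKernel (hv i hi)
  have hpt : ∀ᵐ t ∂μ, ∀ᵐ s ∂μ, gagKernel (fun x => ∑ i ∈ I, v i x) t s ≤
      (2 * N : ℕ) * ∑ i ∈ I, gagKernel (v i) t s := by
    filter_upwards [hN] with t ht
    filter_upwards [hN] with s hs
    set J := I.filter fun i => v i t - v i s ≠ 0 with hJ
    have hJc : J.card ≤ 2 * N := by
      have : J ⊆ (I.filter fun i => v i t ≠ 0) ∪ (I.filter fun i => v i s ≠ 0) := by
        intro i hi
        obtain ⟨hiI, hi⟩ := Finset.mem_filter.1 hi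
        rw [Finset.mem_union, Finset.mem_filter, Finset.mem_filter]
        by_contra! hcon
        exact hi (by rw [hcon.1 hiI, hcon.2 hiI, sub_zero])
      have h1 := (Finset.card_le_card this).trans (Finset.card_union_le _ _)
      omega
    have hsum : (∑ i ∈ I, v i t - ∑ i ∈ I, v i s) ^ 2 ≤
        (2 * N : ℕ) * ∑ i ∈ I, (v i t - v i s) ^ 2 := by
      rw [← Finset.sum_sub_distrib, ← Finset.sum_filter_ne_zero]
      refine sq_sum_le_card_mul_sum_sq.trans ?_
      have h1 : ∑ i ∈ J, (v i t - v i s) ^ 2 ≤ ∑ i ∈ I, (v i t - v i s) ^ 2 :=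
        Finset.sum_le_sum_of_subset_of_nonneg (Finset.filter_subset _ _) fun i _ _ => sq_nonneg _
      gcongr
    have hen : ∀ x : ℝ, ‖x‖ₑ ^ 2 = ENNReal.ofReal (x ^ 2) := fun x => by
      rw [Real.enorm_eq_ofReal_abs, ← ENNReal.ofReal_pow (abs_nonneg _), sq_abs]
    simp only [gagKernel, hen, div_eq_mul_inv]
    rw [← Finset.sum_mul, ← mul_assoc, ← ENNReal.ofReal_sum_of_nonneg fun i _ => sq_nonneg _,
      ← ENNReal.ofReal_natCast, ← ENNReal.ofReal_mul (by positivity)]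
    gcongr
  calc _ ≤ ∫⁻ t, ∫⁻ s, (2 * N : ℕ) * ∑ i ∈ I, gagKernel (v i) t s ∂μ ∂μ :=
        lintegral_mono_ae (hpt.mono fun t ht => lintegral_mono_ae ht)
    _ = ∫⁻ t, (2 * N : ℕ) * ∑ i ∈ I, ∫⁻ s, gagKernel (v i) t s ∂μ ∂μ := by
        refine lintegral_congr fun t => ?_
        rw [lintegral_const_mul' _ _ (by finiteness), lintegral_finsetSum' I fun i hi =>
          (measurable_gagKernel_right (hv i hi) t).aemeasurable]
    _ = _ := by
        rw [lintegral_const_mul' _ _ (by finiteness), lintegral_finsetSum' I fun i hi =>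
          ((hk i hi).lintegral_prod_right').aemeasurable]

end

/-! ### Duality -/

/-- The suprema defining the dual norms need not be attained, so they are approached strictly from
below; `b i = 0` covers `a i = 0`. -/
theorem sum_sq_le_of_forall_lt {ι : Type*} (s : Finset ι) {a : ι → ℝ≥0∞} (ha : ∀ i ∈ s, a i ≠ ∞)
    {D : ℝ≥0∞} (h : ∀ b : ι → ℝ≥0, (∀ i ∈ s, b i = 0 ∨ (b i : ℝ≥0∞) < a i) →
      ∑ i ∈ s, (b i : ℝ≥0∞) ^ 2 ≤ D) : ∑ i ∈ s, a i ^ 2 ≤ D := by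
  refine ENNReal.le_of_forall_lt_one_mul_le fun θ hθ => ?_
  lift θ to ℝ≥0 using (hθ.trans_le le_top).ne
  have hθ1 : θ < 1 := by exact_mod_cast hθ
  -- Then `η < 1`, and `η² - θ = ((1 - θ) / 2)² ≥ 0`.
  set η : ℝ≥0 := (1 + θ) / 2 with hη
  have hη1 : η < 1 := by
    rw [hη, div_lt_one (by norm_num)]
    calc 1 + θ < 1 + 1 := by gcongr
      _ = 2 := by norm_num
  have hθη : θ ≤ η ^ 2 := by
    rw [← NNReal.coe_le_coe, hη]
    push_cast
    nlinarith [sq_nonneg (1 - (θ : ℝ))]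
  have hb := h (fun i => η * (a i).toNNReal) fun i hi => ?_
  · refine le_trans ?_ hb
    rw [Finset.mul_sum]
    refine Finset.sum_le_sum fun i hi => ?_
    rw [ENNReal.coe_mul, ENNReal.coe_toNNReal (ha i hi), mul_pow]
    gcongr
    exact_mod_cast hθη
  · rcases eq_or_ne (a i) 0 with h0 | h0
    · left; simp [h0]
    · right
      rw [ENNReal.coe_mul, ENNReal.coe_toNNReal (ha i hi)]
      calc (η : ℝ≥0∞) * a i < 1 * a i := by
            rw [ENNReal.mul_lt_mul_iff_left h0 (ha i hi)]; exact_mod_cast hη1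
        _ = a i := one_mul _

theorem sq_sum_mul_le {ι : Type*} (s : Finset ι) (f g : ι → ℝ≥0∞) :
    (∑ i ∈ s, f i * g i) ^ 2 ≤ (∑ i ∈ s, f i ^ 2) * ∑ i ∈ s, g i ^ 2 := by
  have h := ENNReal.inner_le_Lp_mul_Lq s f g (p := 2) (q := 2) Real.HolderConjugate.two_two
  have h2 := pow_le_pow_left' h 2
  rw [mul_pow, ← ENNReal.rpow_mul_natCast, ← ENNReal.rpow_mul_natCast] at h2
  norm_num at h2
  exact h2

section

variable {n : ℕ} {Γ : Set (E n)}

theorem HHalf.ext_ae {u v : HHalf Γ} (h : (u.1 : E n → ℝ) =ᵐ[surfaceMeasure Γ] v.1) : u = v :=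
  Subtype.ext (Lp.ext h)

theorem MemHHalf.coeFn_toHHalf {f : E n → ℝ} (hf : MemHHalf Γ f) :
    (hf.toHHalf.1 : E n → ℝ) =ᵐ[surfaceMeasure Γ] f := hf.1.coeFn_toLp

theorem HHalf.coeFn_add (u v : HHalf Γ) :
    ((u + v).1 : E n → ℝ) =ᵐ[surfaceMeasure Γ] fun x => u.1 x + v.1 x := Lp.coeFn_add _ _

theorem HHalf.coeFn_sub (u v : HHalf Γ) :
    ((u - v).1 : E n → ℝ) =ᵐ[surfaceMeasure Γ] fun x => u.1 x - v.1 x := Lp.coeFn_sub _ _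

theorem HHalf.coeFn_smul (a : ℝ) (v : HHalf Γ) :
    ((a • v).1 : E n → ℝ) =ᵐ[surfaceMeasure Γ] fun x => a * v.1 x := Lp.coeFn_smul _ _

theorem HHalf.coeFn_sum {ι : Type*} (s : Finset ι) (v : ι → HHalf Γ) :
    ((∑ i ∈ s, v i).1 : E n → ℝ) =ᵐ[surfaceMeasure Γ] fun x => ∑ i ∈ s, (v i).1 x := by
  rw [show (∑ i ∈ s, v i).1 = ∑ i ∈ s, (v i).1 from map_sum (HHalf Γ).subtype v s]
  exact Lp.coeFn_fun_finsetSum s fun i => (v i).1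

theorem HHalf.measurable (v : HHalf Γ) : Measurable (v.1 : E n → ℝ) :=
  (Lp.stronglyMeasurable v.1).measurable

theorem seminormSq_ne_top (v : HHalf Γ) : seminormSq Γ v.1 ≠ ∞ := ne_of_lt v.2

theorem seminormSq_smul (a : ℝ) (v : HHalf Γ) :
    seminormSq Γ (a • v).1 = ‖a‖ₑ ^ 2 * seminormSq Γ v.1 := by
  have hc : ‖a‖ₑ ^ 2 ≠ ∞ := by simp
  rw [seminormSq_congr (HHalf.coeFn_smul a v)]
  unfold seminormSq
  rw [← lintegral_const_mul' _ _ hc]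
  refine lintegral_congr fun t => ?_
  rw [← lintegral_const_mul' _ _ hc]
  refine lintegral_congr fun s => ?_
  rw [← mul_sub, enorm_mul, mul_pow, mul_div_assoc]

theorem memHHalf_const [IsFiniteMeasure (surfaceMeasure Γ)] (a : ℝ) :
    MemHHalf Γ fun _ => a :=
  ⟨memLp_const a, by simp [seminormSq]⟩

theorem rpow_half_sq (x : ℝ≥0∞) : (x ^ (1 / 2 : ℝ)) ^ 2 = x := by
  rw [← ENNReal.rpow_mul_natCast]; norm_num

theorem normHHalf_sq (v : HHalf Γ) : normHHalf v ^ 2 =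
    ∫⁻ t, ‖v.1 t‖ₑ ^ 2 ∂(surfaceMeasure Γ) + seminormSq Γ v.1 := by
  rw [normHHalf, rpow_half_sq]
  congr 1
  have h := eLpNorm_nnreal_pow_eq_lintegral (f := (v.1 : E n → ℝ)) (μ := surfaceMeasure Γ)
    (p := 2) (by norm_num)
  simpa using h

theorem normHHalf_ne_top (v : HHalf Γ) : normHHalf v ≠ ∞ := by
  refine ENNReal.rpow_ne_top_of_nonneg (by norm_num) (ENNReal.add_ne_top.2 ⟨?_, seminormSq_ne_top v⟩)
  exact ENNReal.pow_ne_top (Lp.eLpNorm_ne_top v.1)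

theorem normHHalf00_sq {τ : Set (E n)} (v : HHalf00 Γ τ) :
    normHHalf00 v ^ 2 = seminormSq Γ v.1.1 := by rw [normHHalf00, rpow_half_sq]

theorem normHHalf00_ne_top {τ : Set (E n)} (v : HHalf00 Γ τ) : normHHalf00 v ≠ ∞ :=
  ENNReal.rpow_ne_top_of_nonneg (by norm_num) (seminormSq_ne_top v.1)

theorem enorm_le_negNorm_mul {ζ : HHalf Γ →ₗ[ℝ] ℝ} (hζ : ζ ∈ HNegHalf Γ) (v : HHalf Γ) :
    ‖ζ v‖ₑ ≤ negNorm ζ * normHHalf v := by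
  rcases eq_or_ne v 0 with rfl | hv
  · simp
  have hfin : negNorm ζ ≠ ∞ := ne_of_lt hζ
  exact (ENNReal.div_le_iff_le_mul (Or.inr hfin) (Or.inl (normHHalf_ne_top v))).1
    (le_iSup₂ (f := fun (v : HHalf Γ) (_ : v ≠ 0) => ‖ζ v‖ₑ / normHHalf v) v hv)

theorem enorm_le_negNormTilde_mul {τ : Set (E n)} {ζ : HHalf Γ →ₗ[ℝ] ℝ}
    (hζ : negNormTilde τ ζ ≠ ∞) (v : HHalf00 Γ τ) :
    ‖ζ v.1‖ₑ ≤ negNormTilde τ ζ * normHHalf00 v := by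
  rcases eq_or_ne v 0 with rfl | hv
  · simp
  exact (ENNReal.div_le_iff_le_mul (Or.inr hζ) (Or.inl (normHHalf00_ne_top v))).1
    (le_iSup₂ (f := fun (v : HHalf00 Γ τ) (_ : v ≠ 0) => ‖ζ v.1‖ₑ / normHHalf00 v) v hv)

/-- Subtracting the Poincaré constant `c` changes neither `ζ w` nor the seminorm, and the `L²` part
of the norm is then controlled by the seminorm. -/
theorem enorm_sq_le_of_const_eq_zero [IsFiniteMeasure (surfaceMeasure Γ)] (hΓ : MeasurableSet Γ)
    (h0 : surfaceMeasure Γ Γ ≠ 0) {d : ℝ≥0∞} (hdt : d ≠ ∞) (hd : ∀ x ∈ Γ, ∀ y ∈ Γ, edist x y ≤ d)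
    {ζ : HHalf Γ →ₗ[ℝ] ℝ} (hζ : ζ ∈ HNegHalf Γ)
    (hconst : ∀ a : ℝ, ζ (memHHalf_const (Γ := Γ) a).toHHalf = 0) (w : HHalf Γ) :
    ‖ζ w‖ₑ ^ 2 ≤ (d ^ n / surfaceMeasure Γ Γ + 1) * negNorm ζ ^ 2 * seminormSq Γ w.1 := by
  obtain ⟨c, hc⟩ := exists_lintegral_sub_sq_le (μ := surfaceMeasure Γ) (HHalf.measurable w) hΓ h0
    (measure_ne_top _ _) hdt hd
  have hrr : (surfaceMeasure Γ).restrict Γ = surfaceMeasure Γ := by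
    rw [surfaceMeasure, Measure.restrict_restrict hΓ, inter_self]
  rw [hrr, ← seminormSq_eq] at hc
  set u := w - (memHHalf_const (Γ := Γ) c).toHHalf with hu
  have huw : (u.1 : E n → ℝ) =ᵐ[surfaceMeasure Γ] fun x => w.1 x - c := by
    filter_upwards [HHalf.coeFn_sub w (memHHalf_const (Γ := Γ) c).toHHalf,
      (memHHalf_const (Γ := Γ) c).coeFn_toHHalf] with x h1 h2
    rw [h1, h2]
  have hζu : ζ w = ζ u := by rw [hu, map_sub, hconst, sub_zero]
  have hsu : seminormSq Γ u.1 = seminormSq Γ w.1 := by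
    rw [seminormSq_congr huw]
    simp [seminormSq]
  have hlu : ∫⁻ t, ‖u.1 t‖ₑ ^ 2 ∂(surfaceMeasure Γ) =
      ∫⁻ t, ‖w.1 t - c‖ₑ ^ 2 ∂(surfaceMeasure Γ) :=
    lintegral_congr_ae (huw.mono fun x hx => by simp only [hx])
  have h1 := pow_le_pow_left' (enorm_le_negNorm_mul hζ u) 2
  rw [mul_pow, normHHalf_sq, hsu, hlu, ← hζu] at h1
  refine h1.trans ?_
  rw [mul_right_comm, mul_comm]
  refine mul_le_mul' ?_ le_rfl
  rw [add_mul, one_mul]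
  gcongr

theorem negNormTilde_sq_le {τ : Set (E n)} {ζ : HHalf Γ →ₗ[ℝ] ℝ} {D : ℝ≥0∞} (hD : D ≠ ∞)
    (h : ∀ w : HHalf00 Γ τ, ‖ζ w.1‖ₑ ^ 2 ≤ D * seminormSq Γ w.1.1) :
    negNormTilde τ ζ ^ 2 ≤ D := by
  have hD2 : D ^ (1 / 2 : ℝ) ≠ ∞ := ENNReal.rpow_ne_top_of_nonneg (by norm_num) hD
  have key : negNormTilde τ ζ ≤ D ^ (1 / 2 : ℝ) := by
    refine iSup₂_le fun w _ => ?_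
    rw [ENNReal.div_le_iff_le_mul (Or.inr hD2) (Or.inl (normHHalf00_ne_top w)),
      ← ENNReal.pow_le_pow_left_iff two_ne_zero, mul_pow, rpow_half_sq, normHHalf00_sq]
    exact h w
  exact (pow_le_pow_left' key 2).trans (rpow_half_sq D).le

theorem exists_dual_element {τ : Set (E n)} {ζ : HHalf Γ →ₗ[ℝ] ℝ} (hζ : negNormTilde τ ζ ≠ ∞)
    {b : ℝ≥0} (hb : b = 0 ∨ (b : ℝ≥0∞) < negNormTilde τ ζ) :
    ∃ w : HHalf00 Γ τ, ζ w.1 = b ^ 2 ∧ seminormSq Γ w.1.1 ≤ b ^ 2 := by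
  rcases hb with rfl | hb
  · refine ⟨0, by simp, ?_⟩
    have h := seminormSq_smul 0 (0 : HHalf Γ)
    rw [zero_smul] at h
    simpa using h.le
  obtain ⟨w, hw⟩ := lt_iSup_iff.1 hb
  obtain ⟨-, hw⟩ := lt_iSup_iff.1 hw
  have hle := enorm_le_negNormTilde_mul hζ w
  set q := seminormSq Γ w.1.1 with hq
  set z := ζ w.1 with hz
  have hz0 : z ≠ 0 := by
    intro h0
    rw [h0, enorm_zero, ENNReal.zero_div] at hw
    exact not_lt_bot hw
  have hlt : (b : ℝ≥0∞) ^ 2 * q ≤ ‖z‖ₑ ^ 2 := by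
    -- Where the seminorm vanishes, finiteness of the local dual norm forces `ζ w = 0`.
    have hne : normHHalf00 w ≠ 0 := by
      intro h0
      rw [h0, mul_zero, nonpos_iff_eq_zero, enorm_eq_zero] at hle
      exact hz0 hle
    have h1 := (ENNReal.le_div_iff_mul_le (Or.inl hne) (Or.inl (normHHalf00_ne_top w))).1 hw.le
    have h2 := pow_le_pow_left' h1 2
    rwa [mul_pow, normHHalf00_sq] at h2
  -- This scaling gives `ζ` the value `b²`, and the seminorm squared becomes `b⁴ q / z² ≤ b²` by
  -- `hlt`.
  refine ⟨((b : ℝ) ^ 2 / z) • w, ?_, ?_⟩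
  · change ζ (((b : ℝ) ^ 2 / z) • w.1) = _
    rw [map_smul, smul_eq_mul, ← hz, div_mul_cancel₀ _ hz0]
  · change seminormSq Γ (((b : ℝ) ^ 2 / z) • w.1).1 ≤ _
    have hze : ‖z‖ₑ ^ 2 ≠ 0 := pow_ne_zero _ (by simpa using hz0)
    have hzt : ‖z‖ₑ ^ 2 ≠ ∞ := by finiteness
    have e1 : ‖(b : ℝ) ^ 2 / z‖ₑ ^ 2 * ‖z‖ₑ ^ 2 = (b : ℝ≥0∞) ^ 2 * (b : ℝ≥0∞) ^ 2 := by
      rw [← mul_pow, ← enorm_mul, div_mul_cancel₀ _ hz0, enorm_pow, Real.enorm_eq_ofReal b.coe_nonneg,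
        ENNReal.ofReal_coe_nnreal]
      ring
    rw [seminormSq_smul, ← hq, ← ENNReal.mul_le_mul_iff_left hze hzt, mul_right_comm, e1, mul_assoc]
    gcongr

end

/-! ### Cutoff products in the patch spaces and the two bounds -/

theorem exists_cutoff_product {n : ℕ} (hn : 2 ≤ n) {Γ : Set (E n)}
    [IsFiniteMeasure (surfaceMeasure Γ)] {A c : ℝ≥0} (hc : 0 < c)
    (hA : ∀ (x : E n) (r : ℝ), 0 ≤ r →
      surfaceMeasure Γ (Metric.closedBall x r) ≤ A * ENNReal.ofReal r ^ (n - 1))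
    {h : ℝ} (hh : 0 < h) {S : Set (E n)} (hS : MeasurableSet S)
    (hSd : ∀ x ∈ S, ∀ y ∈ S, dist x y ≤ 2 * h)
    (hSμ : c * ENNReal.ofReal h ^ (n - 1) ≤ surfaceMeasure Γ S)
    {B : ℝ} {φ : E n → ℝ} (hφ : MemHHalf Γ φ)
    (hφ0 : ∀ᵐ s ∂(surfaceMeasure Γ), s ∉ S → φ s = 0)
    (hφB : ∀ᵐ s ∂(surfaceMeasure Γ), |φ s| ≤ B)
    (hφL : ∀ᵐ t ∂(surfaceMeasure Γ), ∀ᵐ s ∂(surfaceMeasure Γ),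
      |φ t - φ s| ≤ B * min 1 (dist t s / h)) (v : HHalf Γ) :
    ∃ (a : ℝ) (w : HHalf00 Γ S), seminormSq Γ w.1.1 ≤
        2 * (ENNReal.ofReal (2 * B ^ 2) * (1 + A * 2 ^ (n + 2) * 2 ^ n / c)) *
          ∫⁻ t in S, ∫⁻ s, gagKernel v.1 t s ∂(surfaceMeasure Γ) ∂(surfaceMeasure Γ) ∧
      (w.1.1 : E n → ℝ) =ᵐ[surfaceMeasure Γ] fun x => φ x * (v.1 x - a) := by
  have hv := HHalf.measurable v
  obtain ⟨ψ, hψ, hφψ⟩ : ∃ ψ, Measurable ψ ∧ φ =ᵐ[surfaceMeasure Γ] ψ :=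
    ⟨hφ.1.1.mk, hφ.1.1.stronglyMeasurable_mk.measurable, hφ.1.1.ae_eq_mk⟩
  have hψ0 : ∀ᵐ s ∂(surfaceMeasure Γ), s ∉ S → ψ s = 0 := by
    filter_upwards [hφ0, hφψ] with s h1 h2
    rwa [← h2]
  have hψB : ∀ᵐ s ∂(surfaceMeasure Γ), |ψ s| ≤ B := by
    filter_upwards [hφB, hφψ] with s h1 h2
    rwa [← h2]
  have hψL : ∀ᵐ t ∂(surfaceMeasure Γ), ∀ᵐ s ∂(surfaceMeasure Γ),
      |ψ t - ψ s| ≤ B * min 1 (dist t s / h) := by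
    filter_upwards [hφL, hφψ] with t h1 h2
    filter_upwards [h1, hφψ] with s h3 h4
    rwa [← h2, ← h4]
  obtain ⟨a, ha⟩ := exists_cutoff_seminorm_le hn hc hA hh hS hSd hSμ hψ hψ0 hψB hψL hv
  have hfin : ∫⁻ t in S, ∫⁻ s, gagKernel v.1 t s ∂(surfaceMeasure Γ) ∂(surfaceMeasure Γ) ≠ ∞ :=
    ((setLIntegral_le_lintegral S _).trans_lt v.2).ne
  have hc' : (c : ℝ≥0∞) ≠ 0 := by positivity
  have hmem : MemHHalf Γ fun x => ψ x * (v.1 x - a) := by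
    refine ⟨?_, ha.trans_lt ?_⟩
    · refine MemLp.of_le_mul (c := B) ((Lp.memLp v.1).sub (memLp_const a))
        (hψ.mul (hv.sub_const a)).aestronglyMeasurable ?_
      filter_upwards [hψB] with s hs
      rw [norm_mul]
      exact mul_le_mul_of_nonneg_right hs (norm_nonneg _)
    · exact lt_top_iff_ne_top.2 (by finiteness)
  refine ⟨a, ⟨hmem.toHHalf, ?_⟩, ?_, ?_⟩
  · change ∀ᵐ s ∂(surfaceMeasure Γ), s ∉ S → hmem.toHHalf.1 s = 0
    filter_upwards [hmem.coeFn_toHHalf, hψ0] with s h1 h2 hs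
    rw [h1, h2 hs, zero_mul]
  · exact (seminormSq_congr hmem.coeFn_toHHalf).le.trans ha
  · filter_upwards [hmem.coeFn_toHHalf, hφψ] with s h1 h2
    rw [h1, h2]

-- Testing with `∑ w_y` gives `X² ≤ D · 2N · X` for `X = ∑ b_y²`. As `X` is finite it can be
-- cancelled.
open Classical in
theorem sum_negNormTilde_sq_le {n : ℕ} {Γ : Set (E n)} [IsFiniteMeasure (surfaceMeasure Γ)]
    (I : Finset (E n)) {S : E n → Set (E n)} {N : ℕ}
    (hN : ∀ t, (I.filter fun y => t ∈ S y).card ≤ N) {ζ : HHalf Γ →ₗ[ℝ] ℝ} {D : ℝ≥0∞}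
    (hD : D ≠ ∞) (hζ : ∀ w : HHalf Γ, ‖ζ w‖ₑ ^ 2 ≤ D * seminormSq Γ w.1) :
    ∑ y ∈ I, negNormTilde (S y) ζ ^ 2 ≤ D * (2 * N : ℕ) := by
  have hfin : ∀ y, negNormTilde (S y) ζ ≠ ∞ := fun y h => by
    have h1 := negNormTilde_sq_le (τ := S y) hD fun w => hζ w.1
    rw [h] at h1
    exact hD (top_le_iff.1 (by simpa using h1))
  refine sum_sq_le_of_forall_lt I (fun y _ => hfin y) fun b hb => ?_
  have hex : ∀ y, ∃ w : HHalf00 Γ (S y), y ∈ I → ζ w.1 = b y ^ 2 ∧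
      seminormSq Γ w.1.1 ≤ b y ^ 2 := fun y => by
    by_cases hy : y ∈ I
    · obtain ⟨w, hw⟩ := exists_dual_element (hfin y) (hb y hy)
      exact ⟨w, fun _ => hw⟩
    · exact ⟨0, fun h => absurd h hy⟩
  choose w hw using hex
  set X := ∑ y ∈ I, (b y : ℝ≥0∞) ^ 2 with hX
  have hXt : X ≠ ∞ := ENNReal.sum_ne_top.2 fun y _ => by finiteness
  have h1 : ‖ζ (∑ y ∈ I, (w y).1)‖ₑ = X := by
    rw [map_sum, Finset.sum_congr rfl fun y hy => (hw y hy).1,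
      Real.enorm_eq_ofReal (Finset.sum_nonneg fun y _ => sq_nonneg _),
      ENNReal.ofReal_sum_of_nonneg fun y _ => sq_nonneg _, hX]
    refine Finset.sum_congr rfl fun y _ => ?_
    rw [ENNReal.ofReal_pow (b y).coe_nonneg, ENNReal.ofReal_coe_nnreal]
  have h2 : seminormSq Γ (∑ y ∈ I, (w y).1).1 ≤ (2 * N : ℕ) * X := by
    rw [seminormSq_congr (HHalf.coeFn_sum I fun y => (w y).1)]
    refine (lintegral_gagKernel_sum_le I (v := fun y => (w y).1.1) (N := N)
      (fun y _ => HHalf.measurable _) ?_).trans ?_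
    · have h3 : ∀ᵐ t ∂(surfaceMeasure Γ), ∀ y ∈ I, t ∉ S y → (w y).1.1 t = 0 :=
        (eventually_all_finset I).2 fun y _ => (w y).2
      filter_upwards [h3] with t ht
      refine (Finset.card_le_card fun y hy => ?_).trans (hN t)
      obtain ⟨hyI, hy⟩ := Finset.mem_filter.1 hy
      exact Finset.mem_filter.2 ⟨hyI, by_contra fun hn => hy (ht y hyI hn)⟩
    · exact mul_le_mul' le_rfl (Finset.sum_le_sum fun y hy => (hw y hy).2)
  have h3 := hζ (∑ y ∈ I, (w y).1)
  rw [h1] at h3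
  have h4 : X * X ≤ D * (2 * N : ℕ) * X := by
    rw [← sq, mul_assoc]
    exact h3.trans (mul_le_mul' le_rfl h2)
  rcases eq_or_ne X 0 with h0 | h0
  · rw [h0]; exact bot_le
  · exact (ENNReal.mul_le_mul_iff_left h0 hXt).1 h4

-- Cauchy–Schwarz over the patches. Only the outer variable is localized, and finite overlap in that
-- variable alone bounds the sum of the integrals by `N` times the full seminorm squared.
open Classical in
theorem negNorm_sq_le {n : ℕ} {Γ : Set (E n)} (I : Finset (E n)) {S : E n → Set (E n)} {N : ℕ}
    (hN : ∀ t, (I.filter fun y => t ∈ S y).card ≤ N) (hS : ∀ y ∈ I, MeasurableSet (S y))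
    {ζ : HHalf Γ →ₗ[ℝ] ℝ} (hfin : ∀ y, negNormTilde (S y) ζ ≠ ∞) {P : ℝ≥0∞}
    (hζ : ∀ v : HHalf Γ, ∃ w : ∀ y, HHalf00 Γ (S y), ζ v = ∑ y ∈ I, ζ (w y).1 ∧
      ∀ y ∈ I, seminormSq Γ (w y).1.1 ≤ P *
        ∫⁻ t in S y, ∫⁻ s, gagKernel v.1 t s ∂(surfaceMeasure Γ) ∂(surfaceMeasure Γ))
    [SFinite (surfaceMeasure Γ)] :
    negNorm ζ ^ 2 ≤ P * N * ∑ y ∈ I, negNormTilde (S y) ζ ^ 2 := by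
  set X := ∑ y ∈ I, negNormTilde (S y) ζ ^ 2
  have key : negNorm ζ ≤ (P * N * X) ^ (1 / 2 : ℝ) := by
    refine iSup₂_le fun v _ => ENNReal.div_le_of_le_mul ?_
    rw [← ENNReal.pow_le_pow_left_iff two_ne_zero, mul_pow, rpow_half_sq, normHHalf_sq]
    obtain ⟨w, hw, hwq⟩ := hζ v
    have h1 : ‖ζ v‖ₑ ≤ ∑ y ∈ I, negNormTilde (S y) ζ * normHHalf00 (w y) := by
      rw [hw]
      exact (enorm_sum_le _ _).trans
        (Finset.sum_le_sum fun y _ => enorm_le_negNormTilde_mul (hfin y) (w y))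
    refine (pow_le_pow_left' h1 2).trans ((sq_sum_mul_le _ _ _).trans ?_)
    have h2 : ∑ y ∈ I, normHHalf00 (w y) ^ 2 ≤ P * (N * seminormSq Γ v.1) := by
      simp only [normHHalf00_sq]
      refine (Finset.sum_le_sum hwq).trans ?_
      rw [← Finset.mul_sum]
      exact mul_le_mul' le_rfl (sum_setLIntegral_le I hS hN
        (measurable_gagKernel (HHalf.measurable v)).lintegral_prod_right')
    calc X * ∑ y ∈ I, normHHalf00 (w y) ^ 2 ≤ X * (P * (N * seminormSq Γ v.1)) := by gcongr
      _ = P * N * X * seminormSq Γ v.1 := by ring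
      _ ≤ _ := by gcongr; exact le_add_self
  exact (pow_le_pow_left' key 2).trans (rpow_half_sq _).le

/-! ### Finiteness of the surface measure and the case of measure zero -/

theorem isFiniteMeasure_surfaceMeasure {n : ℕ} {Γ : Set (E n)} (hΓ : IsCompact Γ) {A : ℝ≥0}
    (hA : ∀ (x : E n) (r : ℝ), 0 ≤ r →
      surfaceMeasure Γ (Metric.closedBall x r) ≤ A * ENNReal.ofReal r ^ (n - 1)) :
    IsFiniteMeasure (surfaceMeasure Γ) := by
  obtain ⟨R, hR⟩ := hΓ.isBounded.subset_closedBall (0 : E n)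
  refine ⟨?_⟩
  have h1 : surfaceMeasure Γ univ = surfaceMeasure Γ Γ := by
    simp [surfaceMeasure]
  rw [h1]
  refine (measure_mono (hR.trans (Metric.closedBall_subset_closedBall (le_max_left R 0)))).trans_lt
    ((hA 0 (max R 0) (le_max_right _ _)).trans_lt (lt_top_iff_ne_top.2 (by finiteness)))

theorem negNorm_eq_zero_of_subsingleton {n : ℕ} {Γ : Set (E n)} [Subsingleton (HHalf Γ)]
    (ζ : HHalf Γ →ₗ[ℝ] ℝ) : negNorm ζ = 0 :=
  le_antisymm (iSup₂_le fun v hv => absurd (Subsingleton.elim v 0) hv) bot_le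

theorem negNormTilde_eq_zero_of_subsingleton {n : ℕ} {Γ τ : Set (E n)} [Subsingleton (HHalf Γ)]
    (ζ : HHalf Γ →ₗ[ℝ] ℝ) : negNormTilde τ ζ = 0 :=
  le_antisymm (iSup₂_le fun v hv => absurd (Subsingleton.elim v 0) hv) bot_le

theorem subsingleton_HHalf {n : ℕ} {Γ : Set (E n)} (h : surfaceMeasure Γ Γ = 0) :
    Subsingleton (HHalf Γ) := by
  have h0 : surfaceMeasure Γ = 0 := by
    rw [surfaceMeasure, Measure.restrict_apply_self] at h
    exact Measure.restrict_eq_zero.2 h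
  have hu : surfaceMeasure Γ univ = 0 := by rw [h0]; rfl
  exact ⟨fun u v => HHalf.ext_ae (ae_iff.2 (measure_mono_null (subset_univ _) hu))⟩

end TraceNorms
end

/-! ### The norm equivalence -/

open TraceNorms in
theorem mainTheorem3 (n : ℕ) (hn : n = 2 ∨ n = 3) (Ω : Set (E n))
    (hΩ : IsLipschitzDomain Ω) (hΩb : Bornology.IsBounded Ω) (hΩs : IsSimplyConnected Ω)
    (hΓ : IsNondegenerate (frontier Ω)) (κ c₀ c₁ : ℝ) (hκ : 0 < κ) :
    ∃ C : ℝ≥0, 0 < C ∧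
      ∀ M : Mesh (frontier Ω), M.IsShapeRegular κ → M.IsQuasiUniform κ →
      ∀ (φ : E n → E n → ℝ)
        (hφ : ∀ y ∈ M.nodes, MemHHalf (frontier Ω) (φ y)),
        (∀ y ∈ M.nodes, MemW1Inf0 (frontier Ω) (M.patch y) (φ y)) →
        (∀ y ∈ M.nodes, norm0Inf (M.patch y) (φ y) ≤ ENNReal.ofReal c₀) →
        (∀ y ∈ M.nodes,
          seminorm1Inf (frontier Ω) (M.patch y) (φ y) ≤ ENNReal.ofReal (c₁ / M.size)) →
        (∀ᵐ s ∂(surfaceMeasure (frontier Ω)), ∑ y ∈ M.nodes, φ y s = 1) →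
      ∀ ζ ∈ HNegHalf (frontier Ω),
        (∀ (y : E n) (hy : y ∈ M.nodes), ζ (hφ y hy).toHHalf = 0) →
          negNorm ζ ^ 2 ≤ C * ∑ y ∈ M.nodes, negNormTilde (M.patch y) ζ ^ 2 ∧
          ∑ y ∈ M.nodes, negNormTilde (M.patch y) ζ ^ 2 ≤ C * negNorm ζ ^ 2 := by
  have hn2 : 2 ≤ n := by omega
  have hcomp := isCompact_frontier_of_isBounded hΩb
  have hΓm : MeasurableSet (frontier Ω) := isClosed_frontier.measurableSet
  obtain ⟨A, hA⟩ := frontier_measure_closedBall_le hΩ hΩb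
  have hfinμ := isFiniteMeasure_surfaceMeasure hcomp hA
  obtain ⟨N, c, hc, hNc⟩ := Mesh.exists_patch_bounds hn2 hκ hA
  obtain ⟨B, -, hBφ⟩ := hΩ.exists_cutoff_bound hΩb c₀ c₁
  -- Poincaré on the frontier divides by its measure. If that is zero, the trace space is trivial
  -- and all dual norms vanish.
  rcases eq_or_ne (surfaceMeasure (frontier Ω) (frontier Ω)) 0 with hμ0 | hμ0
  · have := subsingleton_HHalf hμ0
    refine ⟨1, one_pos, fun M _ _ φ hφ _ _ _ _ ζ _ _ => ?_⟩
    simp [negNorm_eq_zero_of_subsingleton, negNormTilde_eq_zero_of_subsingleton]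
  set μ := surfaceMeasure (frontier Ω)
  set P : ℝ≥0∞ := 2 * (ENNReal.ofReal (2 * B ^ 2) * (1 + A * 2 ^ (n + 2) * 2 ^ n / c)) with hP
  set d : ℝ≥0∞ := ENNReal.ofReal (Metric.diam (frontier Ω))
  have hd : ∀ x ∈ frontier Ω, ∀ y ∈ frontier Ω, edist x y ≤ d := fun x hx y hy => by
    rw [edist_dist]
    exact ENNReal.ofReal_le_ofReal (Metric.dist_le_diam_of_mem hcomp.isBounded hx hy)
  set Q : ℝ≥0∞ := d ^ n / μ (frontier Ω) + 1 with hQ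
  have hc' : (c : ℝ≥0∞) ≠ 0 := by positivity
  have hPt : P ≠ ∞ := by rw [hP]; finiteness
  have hQt : Q ≠ ∞ := by rw [hQ]; finiteness
  -- `P * N` serves the bound on the global norm, `Q * (2 * N)` the bound on the local ones, and `1`
  -- makes `C` positive.
  set C : ℝ≥0∞ := P * N + Q * (2 * N : ℕ) + 1 with hC
  have hCt : C ≠ ∞ := by rw [hC]; finiteness
  refine ⟨C.toNNReal, ENNReal.toNNReal_pos (by positivity) hCt,
    fun M hS hQU φ hφ hφW hφ0 hφ1 hsum ζ hζ hζφ => ?_⟩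
  rw [ENNReal.coe_toNNReal hCt]
  obtain ⟨hN, hcM⟩ := hNc M hS hQU
  have hsumφ : ∀ a : E n → ℝ,
      ζ (∑ y ∈ M.nodes.attach, a y • (hφ y.1 y.2).toHHalf) = 0 := fun a => by
    rw [map_sum]
    exact Finset.sum_eq_zero fun y _ => by rw [map_smul, hζφ y.1 y.2, smul_zero]
  have hcoe : ∀ a : E n → ℝ, ((∑ y ∈ M.nodes.attach, a y • (hφ y.1 y.2).toHHalf).1 : E n → ℝ)
      =ᵐ[μ] fun x => ∑ y ∈ M.nodes, a y * φ y x := fun a => by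
    have h1 : ∀ᵐ x ∂μ, ∀ y ∈ M.nodes.attach, (a y • (hφ y.1 y.2).toHHalf).1 x = a y * φ y x := by
      refine (eventually_all_finset _).2 fun y _ => ?_
      filter_upwards [HHalf.coeFn_smul (a y) (hφ y.1 y.2).toHHalf,
        (hφ y.1 y.2).coeFn_toHHalf] with x h1 h2
      rw [h1, h2]
    filter_upwards [HHalf.coeFn_sum M.nodes.attach fun y => a y • (hφ y.1 y.2).toHHalf, h1]
      with x h2 h3
    rw [h2, Finset.sum_congr rfl h3, Finset.sum_attach M.nodes fun y => a y * φ y x]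
  have hconst : ∀ a : ℝ, ζ (memHHalf_const (Γ := frontier Ω) a).toHHalf = 0 := fun a => by
    rw [← hsumφ fun _ => a]
    congr 1
    refine HHalf.ext_ae ?_
    filter_upwards [(memHHalf_const (Γ := frontier Ω) a).coeFn_toHHalf, hcoe fun _ => a, hsum]
      with x h1 h2 h3
    rw [h1, h2, ← Finset.mul_sum, h3, mul_one]
  have hbound := enorm_sq_le_of_const_eq_zero hΓm hμ0 ENNReal.ofReal_ne_top hd hζ hconst
  have hζt : negNorm ζ ≠ ∞ := ne_of_lt hζ
  have hDt : Q * negNorm ζ ^ 2 ≠ ∞ := by finiteness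
  constructor
  · have hfin : ∀ y, negNormTilde (M.patch y) ζ ≠ ∞ := fun y h => by
      have h1 := negNormTilde_sq_le (τ := M.patch y) hDt fun w => hbound w.1
      rw [h] at h1
      exact hDt (top_le_iff.1 (by simpa using h1))
    refine (negNorm_sq_le M.nodes (S := M.patch) (P := P) hN
      (fun y _ => (M.isClosed_patch y).measurableSet) hfin fun v => ?_).trans ?_
    · have hex : ∀ y, ∃ (a : ℝ) (w : HHalf00 (frontier Ω) (M.patch y)), y ∈ M.nodes →
          seminormSq (frontier Ω) w.1.1 ≤ P * ∫⁻ t in M.patch y, ∫⁻ s, gagKernel v.1 t s ∂μ ∂μ ∧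
          (w.1.1 : E n → ℝ) =ᵐ[μ] fun x => φ y x * (v.1 x - a) := fun y => by
        by_cases hy : y ∈ M.nodes
        swap
        · exact ⟨0, 0, fun h => absurd h hy⟩
        obtain ⟨i, -, -⟩ := M.mem_nodes.1 hy
        have hh := M.size_pos hn2 i
        obtain ⟨hb1, hb2⟩ := hBφ (M.patch y) M.size (φ y) (M.isClosed_patch y) hh
          (M.size_le_diam hcomp.isBounded) (hφW y hy) (hφ0 y hy) (hφ1 y hy)
        have h0 : ∀ᵐ s ∂μ, s ∉ M.patch y → φ y s = 0 := by
          filter_upwards [ae_restrict_mem hΓm] with s hs hsp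
          exact (hφW y hy).2 s ⟨hs, hsp⟩
        obtain ⟨a, w, hw⟩ := exists_cutoff_product hn2 hc hA hh (M.isClosed_patch y).measurableSet
          (fun x hx z hz => by
            have h1 := M.dist_le_of_mem_patch hx
            have h2 := M.dist_le_of_mem_patch hz
            have h3 := dist_triangle_right x z y
            linarith) (hcM y hy) (hφ y hy) h0 hb1 hb2 v
        exact ⟨a, w, fun _ => hw⟩
      choose a w hw using hex
      refine ⟨w, ?_, fun y hy => (hw y hy).1⟩
      -- The partition of unity splits `v`; the constants `a y` removed in the patches reassemble
      -- into a combination of the `φ y`, on which `ζ` vanishes.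
      have hv : v = ∑ y ∈ M.nodes, (w y).1 +
          ∑ y ∈ M.nodes.attach, a y • (hφ y.1 y.2).toHHalf := by
        refine HHalf.ext_ae ?_
        have h1 : ∀ᵐ x ∂μ, ∀ y ∈ M.nodes, (w y).1.1 x = φ y x * (v.1 x - a y) :=
          (eventually_all_finset _).2 fun y hy => (hw y hy).2
        filter_upwards [h1, HHalf.coeFn_add (∑ y ∈ M.nodes, (w y).1)
          (∑ y ∈ M.nodes.attach, a y • (hφ y.1 y.2).toHHalf), hcoe a,
          HHalf.coeFn_sum M.nodes fun y => (w y).1, hsum] with x h1 h2 h3 h4 h5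
        rw [h2, h3, h4, Finset.sum_congr rfl h1, ← Finset.sum_add_distrib]
        calc v.1 x = ∑ y ∈ M.nodes, φ y x * v.1 x := by rw [← Finset.sum_mul, h5, one_mul]
          _ = _ := Finset.sum_congr rfl fun y _ => by ring
      conv_lhs => rw [hv]
      rw [map_add, hsumφ, add_zero, map_sum]
    · gcongr
      rw [hC, add_assoc]
      exact le_self_add
  · refine (sum_negNormTilde_sq_le M.nodes (S := M.patch) hN hDt hbound).trans ?_
    rw [mul_right_comm]
    gcongr
    rw [hC, add_right_comm]
    exact le_add_self
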